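/- Let $K$ be a totally real number field with ring of integers $\mathbb Z_K$. Let $a,b\in K$ be totally positive, i.e. positive under every real embedding of $K$. Let $Q=\left(\frac{-a,-b}{K}\right)$ be the totally definite quaternion algebra with $K$-basis $1,i,j,ij$, where $i^2=-a$, $j^2=-b$, $ij=-ji$. Let $\overline{\phantom{x}}$ be its canonical involution and $n(\alpha)=\alpha\overline\alpha\in K$ the reduced norm. A lattice in $Q$ is a finitely generated $\mathbb Z_K$-submodule that spans $Q$ over $K$. An order is a subring of $Q$ that is a lattice, and a maximal order is an order not properly contained in another order. For a lattice $J$ put $O_r(J)=\{\alpha\in Q: J\alpha\subseteq J\}$, $O_\ell(J)=\{\alpha\in Q:\alpha J\subseteq J\}$ and $n(J)=\sum_{\gamma\in J}\mathbb Z_K n(\gamma)$. The lattice $J$ is normal if $O_r(J)$ is a maximal order. For an order $\mathcal M$ put $N(\mathcal M)=\{\alpha\in Q^*:\alpha\mathcal M\alpha^{-1}=\mathcal M\}$. Let $\mathrm{SO}(Q,n)$ be the group of $K$-linear automorphisms of $Q$ of determinant $1$ that preserve $n$. Lattices $(L,n)$ and $(L',n)$ in $Q$ are properly isometric if $\varphi(L)=L'$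 for some $\varphi\in\mathrm{SO}(Q,n)$, and $\mathrm{Aut}^+(L,n)$ is the stabiliser of $L$ in $\mathrm{SO}(Q,n)$. Let $\mathfrak a$ be a fractional ideal of $\mathbb Z_K$ and $J$ a normal lattice in $Q$ with $n(J)=\mathfrak a$. Define $$C_{\mathfrak a}(J)=\{\alpha J\beta^{-1}:\alpha,\beta\in Q^*,\ n(\alpha)n(\beta^{-1})\in\mathbb Z_K^*\},$$ $$\mathfrak N(J)=\{(\alpha,\beta)\in N(O_\ell(J))\times N(O_r(J)): n(\alpha)n(\beta^{-1})\in\mathbb Z_K^*\},$$ $$U(J)=\{n(\alpha)n(\beta^{-1}):(\alpha,\beta)\in\mathfrak N(J)\},$$ where $U(J)$ is a subgroup of the group $\mathbb Z_{K,>0}^*$ of totally positive units of $\mathbb Z_K$. Let $(\alpha_u)_u$ be any family of elements of $Q^*$, indexed by the cosets $u\in\mathbb Z_{K,>0}^*/U(J)$, such that $n(\alpha_u)\in u$ for every $u$. Then the lattices $(\alpha_uJ,n)$, $u\in\mathbb Z_{K,>0}^*/U(J)$, form a system of representatives of the proper isometry classes of the lattices $(I,n)$ with $I\in C_{\mathfrak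 a}(J)$: each $\alpha_uJ$ lies in $C_{\mathfrak a}(J)$, and every $(I,n)$ with $I\in C_{\mathfrak a}(J)$ is properly isometric to $(\alpha_uJ,n)$ for exactly one $u$. Moreover, for every $u$, $$\mathrm{Aut}^+(\alpha_uJ,n)=\alpha_u\,\mathrm{Aut}^+(J,n)\,\alpha_u^{-1},$$ where $\alpha_u$ acts on $Q$ by left multiplication, and $$\mathrm{Aut}^+(J,n)=\{\gamma\mapsto\alpha\gamma\beta^{-1}:(\alpha,\beta)\in\mathfrak N(J),\ n(\alpha)=n(\beta)\}.$$ -/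

import Mathlib

open scoped NumberField nonZeroDivisors

namespace NormalLattice

noncomputable section

/-- An element of a (totally real) number field is totally positive if it is positive under every
real embedding. -/
def TotallyPositive {K : Type*} [Field K] (x : K) : Prop :=
  ∀ σ : K →+* ℝ, 0 < σ x

/-- The quaternion algebra `Q = (-a, -b / K)` with `K`-basis `1, i, j, ij`, where `i ^ 2 = -a`,
`j ^ 2 = -b` and `i * j = -(j * i)`. Its `star` is the canonical involution
`t + x i + y j + z ij ↦ t - x i - y j - z ij`. -/
abbrev Quat {K : Type*} [Field K] (a b : K) : Type _ := QuaternionAlgebra K (-a) 0 (-b)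

variable {K : Type*} [Field K] {a b : K}

/-- The reduced norm `n(α) = α * star α`, an element of `K`, as a multiplicative map. -/
def nrd : Quat a b →*₀ K where
  toFun x := (x * star x).re
  map_zero' := by simp
  map_one' := by simp
  map_mul' x y := by
    simp only [QuaternionAlgebra.re_mul, QuaternionAlgebra.imI_mul, QuaternionAlgebra.imJ_mul,
      QuaternionAlgebra.imK_mul, QuaternionAlgebra.re_star, QuaternionAlgebra.imI_star,
      QuaternionAlgebra.imJ_star, QuaternionAlgebra.imK_star]
    ring

theorem nrd_eq_mul_star (x : Quat a b) : algebraMap K (Quat a b) (nrd x) = x * star x :=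
  (QuaternionAlgebra.mul_star_eq_coe x).symm

theorem nrd_eq (x : Quat a b) :
    nrd x = x.re ^ 2 + a * x.imI ^ 2 + b * x.imJ ^ 2 + a * b * x.imK ^ 2 := by
  change (x * star x).re = _
  simp only [QuaternionAlgebra.re_mul, QuaternionAlgebra.re_star, QuaternionAlgebra.imI_star,
      QuaternionAlgebra.imJ_star, QuaternionAlgebra.imK_star]
  ring

/-- The reduced norm on unit groups, `Q^* → K^*`. -/
def unitNrd : (Quat a b)ˣ →* Kˣ := Units.map (nrd (a := a) (b := b) : Quat a b →* K)

/-- The homomorphism `(α, β) ↦ n(α) n(β⁻¹)` from `Q^* × Q^*` to `K^*`. -/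
def normRatio : (Quat a b)ˣ × (Quat a b)ˣ →* Kˣ where
  toFun p := unitNrd p.1 * unitNrd p.2⁻¹
  map_one' := by simp
  map_mul' p q := by
    simp only [Prod.fst_mul, Prod.snd_mul, map_mul, map_inv, mul_inv]
    exact mul_mul_mul_comm _ _ _ _

theorem unitNrd_totallyPositive (ha : TotallyPositive a) (hb : TotallyPositive b)
    (x : (Quat a b)ˣ) : TotallyPositive (unitNrd x : K) := by
  intro σ
  have hne : σ (unitNrd x : K) ≠ 0 := (map_ne_zero σ).2 (unitNrd x).ne_zero
  refine lt_of_le_of_ne ?_ hne.symm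
  change 0 ≤ σ (nrd (x : Quat a b))
  rw [nrd_eq]
  have h1 := ha σ
  have h2 := hb σ
  simp only [map_add, map_mul, map_pow]
  positivity

/-! ### Units of the ring of integers -/

/-- The unit group `ℤ_K^*`, as a subgroup of `K^*`. -/
def integralUnits (K : Type*) [Field K] : Subgroup Kˣ :=
  (Units.map (algebraMap (𝓞 K) K : 𝓞 K →* K)).range

/-- The group `ℤ_{K,>0}^*` of totally positive units of `ℤ_K`, as a subgroup of `K^*`. -/
def totPosUnits (K : Type*) [Field K] : Subgroup Kˣ where
  carrier := {x | x ∈ integralUnits K ∧ TotallyPositive (x : K)}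
  one_mem' := ⟨one_mem _, fun σ => by simp⟩
  mul_mem' hx hy := ⟨mul_mem hx.1 hy.1, fun σ => by
    have h1 := hx.2 σ
    have h2 := hy.2 σ
    simpa using mul_pos h1 h2⟩
  inv_mem' hx := ⟨inv_mem hx.1, fun σ => by
    have h1 := hx.2 σ
    simpa using h1⟩

/-! ### Orders and normal lattices

A `ℤ_K`-lattice in `Q` is a `𝓞 K`-submodule `J` with `Submodule.IsLattice K J`: it is finitely
generated and spans `Q` over `K`. -/

/-- An order in `Q` is a subring which is a `ℤ_K`-lattice. -/
def IsOrder (M : Subalgebra (𝓞 K) (Quat a b)) : Prop :=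
  Submodule.IsLattice K (Subalgebra.toSubmodule M)

/-- A maximal order is an order that is maximal with respect to inclusion among all orders. -/
def IsMaximalOrder (M : Subalgebra (𝓞 K) (Quat a b)) : Prop :=
  Maximal IsOrder M

/-- The right order `{α | J α ⊆ J}`. -/
def rightOrder (J : Submodule (𝓞 K) (Quat a b)) : Subalgebra (𝓞 K) (Quat a b) where
  carrier := {α | ∀ x ∈ J, x * α ∈ J}
  mul_mem' hα hβ x hx := by
    rw [← mul_assoc]
    exact hβ _ (hα x hx)
  add_mem' hα hβ x hx := by
    rw [mul_add]
    exact add_mem (hα x hx) (hβ x hx)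
  algebraMap_mem' r x hx := by
    rw [← Algebra.commutes, ← Algebra.smul_def]
    exact J.smul_mem r hx

/-- The left order `{α | α J ⊆ J}`. -/
def leftOrder (J : Submodule (𝓞 K) (Quat a b)) : Subalgebra (𝓞 K) (Quat a b) where
  carrier := {α | ∀ x ∈ J, α * x ∈ J}
  mul_mem' hα hβ x hx := by
    rw [mul_assoc]
    exact hα _ (hβ x hx)
  add_mem' hα hβ x hx := by
    rw [add_mul]
    exact add_mem (hα x hx) (hβ x hx)
  algebraMap_mem' r x hx := by
    rw [← Algebra.smul_def]
    exact J.smul_mem r hx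

/-- A lattice is normal if its right order is a maximal order. -/
def IsNormal (J : Submodule (𝓞 K) (Quat a b)) : Prop :=
  Submodule.IsLattice K J ∧ IsMaximalOrder (rightOrder J)

/-- The norm `n(J)` of a lattice: the `ℤ_K`-submodule of `K` generated by the norms of the elements
of `J`. -/
def latticeNorm (J : Submodule (𝓞 K) (Quat a b)) : Submodule (𝓞 K) K :=
  Submodule.span (𝓞 K) (nrd '' (J : Set (Quat a b)))

/-- The image `f(L)` of a lattice under a `K`-linear map. -/
def latticeImage (f : Quat a b →ₗ[K] Quat a b) (L : Submodule (𝓞 K) (Quat a b)) :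
    Submodule (𝓞 K) (Quat a b) :=
  L.map (f.restrictScalars (𝓞 K))

theorem latticeImage_comp (f g : Quat a b →ₗ[K] Quat a b) (L : Submodule (𝓞 K) (Quat a b)) :
    latticeImage (f ∘ₗ g) L = latticeImage f (latticeImage g L) :=
  Submodule.map_comp (g.restrictScalars (𝓞 K)) (f.restrictScalars (𝓞 K)) L

/-- The lattice `α J β⁻¹`. -/
def twoSidedMul (α β : (Quat a b)ˣ) (J : Submodule (𝓞 K) (Quat a b)) :
    Submodule (𝓞 K) (Quat a b) :=
  latticeImage (LinearMap.mulLeftRight K ((α : Quat a b), ((β⁻¹ : (Quat a b)ˣ) : Quat a b))) J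

/-- The lattice `α J`. -/
def leftMul (α : (Quat a b)ˣ) (J : Submodule (𝓞 K) (Quat a b)) : Submodule (𝓞 K) (Quat a b) :=
  latticeImage (LinearMap.mulLeft K (α : Quat a b)) J

/-- For `𝔞 = n(J)`, the set `C_𝔞(J)` of all lattices `α J β⁻¹` with `α, β ∈ Q^*` and
`n(α) n(β⁻¹) ∈ ℤ_K^*`. -/
def normalisedClass (J : Submodule (𝓞 K) (Quat a b)) : Set (Submodule (𝓞 K) (Quat a b)) :=
  {I | ∃ α β : (Quat a b)ˣ, normRatio (α, β) ∈ integralUnits K ∧ I = twoSidedMul α β J}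

/-- The normaliser `{α ∈ Q^* | α M α⁻¹ = M}` of an order. -/
def orderNormalizer (M : Subalgebra (𝓞 K) (Quat a b)) : Subgroup (Quat a b)ˣ where
  carrier := {α | ∀ x : Quat a b, x ∈ M ↔ (α : Quat a b) * x * ((α⁻¹ : (Quat a b)ˣ) : Quat a b) ∈ M}
  one_mem' x := by simp
  mul_mem' {α β} hα hβ x := by
    rw [hβ x, hα]
    simp [mul_assoc]
  inv_mem' {α} hα x := by
    rw [hα (((α⁻¹ : (Quat a b)ˣ) : Quat a b) * x * (((α⁻¹)⁻¹ : (Quat a b)ˣ) : Quat a b))]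
    simp [mul_assoc]

/-- The group `𝔑(J)` of all `(α, β) ∈ N(O_ℓ(J)) × N(O_r(J))` with `n(α) n(β⁻¹) ∈ ℤ_K^*`. -/
def pairNormalizer (J : Submodule (𝓞 K) (Quat a b)) : Subgroup ((Quat a b)ˣ × (Quat a b)ˣ) :=
  (orderNormalizer (leftOrder J)).prod (orderNormalizer (rightOrder J)) ⊓
    (integralUnits K).comap normRatio

/-- `U(J) = {n(α) n(β⁻¹) | (α, β) ∈ 𝔑(J)}`, as a subgroup of `K^*`. -/
def normUnits (J : Submodule (𝓞 K) (Quat a b)) : Subgroup Kˣ :=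
  (pairNormalizer J).map normRatio

theorem normUnits_le_totPosUnits (ha : TotallyPositive a) (hb : TotallyPositive b)
    (J : Submodule (𝓞 K) (Quat a b)) : normUnits J ≤ totPosUnits K := by
  rintro _ ⟨⟨α, β⟩, hp, rfl⟩
  refine ⟨hp.2, fun σ => ?_⟩
  have h1 := unitNrd_totallyPositive ha hb α σ
  have h2 := unitNrd_totallyPositive ha hb β⁻¹ σ
  simpa [normRatio] using mul_pos h1 h2

/-- The quotient group `ℤ_{K,>0}^* / U(J)`. In a totally definite quaternion algebra `U(J)` is
contained in `ℤ_{K,>0}^*` (`normUnits_le_totPosUnits`), so that `subgroupOf` only changes the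
ambient group. -/
abbrev UnitQuotient (J : Submodule (𝓞 K) (Quat a b)) : Type _ :=
  totPosUnits K ⧸ (normUnits J).subgroupOf (totPosUnits K)

/-! ### Proper isometries -/

/-- The group `SO(Q, n)` of `K`-linear automorphisms of `Q` of determinant `1` that preserve the
reduced norm. -/
def properIsometries (a b : K) : Subgroup (Quat a b ≃ₗ[K] Quat a b) where
  carrier := {φ | (∀ x, nrd (φ x) = nrd x) ∧ LinearEquiv.det φ = 1}
  one_mem' := ⟨fun _ => rfl, map_one _⟩
  mul_mem' {φ ψ} hφ hψ :=
    ⟨fun x => (hφ.1 (ψ x)).trans (hψ.1 x), by rw [map_mul, hφ.2, hψ.2, one_mul]⟩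
  inv_mem' {φ} hφ :=
    ⟨fun x => by
      rw [← hφ.1 (φ⁻¹ x)]
      exact congrArg nrd (φ.apply_symm_apply x), by rw [map_inv, hφ.2, inv_one]⟩

/-- `(L, n)` and `(L', n)` are properly isometric: they lie in one orbit under `SO(Q, n)`. -/
def ProperlyIsometric (L L' : Submodule (𝓞 K) (Quat a b)) : Prop :=
  ∃ φ ∈ properIsometries a b, latticeImage φ.toLinearMap L = L'

/-- The proper isometry group `Aut⁺(L, n)`: the stabiliser of `L` in `SO(Q, n)`. -/
def properAut (L : Submodule (𝓞 K) (Quat a b)) : Subgroup (Quat a b ≃ₗ[K] Quat a b) where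
  carrier := {φ | φ ∈ properIsometries a b ∧ latticeImage φ.toLinearMap L = L}
  one_mem' := ⟨one_mem _, Submodule.map_id L⟩
  mul_mem' {φ ψ} hφ hψ := ⟨mul_mem hφ.1 hψ.1, by
    have h := latticeImage_comp φ.toLinearMap ψ.toLinearMap L
    rw [hψ.2, hφ.2] at h
    exact h⟩
  inv_mem' {φ} hφ := ⟨inv_mem hφ.1, by
    have h := latticeImage_comp (φ⁻¹).toLinearMap φ.toLinearMap L
    have h1 : (φ⁻¹).toLinearMap ∘ₗ φ.toLinearMap = LinearMap.id :=
      LinearMap.ext φ.symm_apply_apply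
    rw [hφ.2, h1] at h
    exact h.symm.trans (Submodule.map_id L)⟩

/-- The conjugate `α G α⁻¹` of a group `G` of automorphisms of `Q`, where `α ∈ Q^*` acts on `Q` by
left multiplication. -/
def conjLeft (α : (Quat a b)ˣ) (G : Subgroup (Quat a b ≃ₗ[K] Quat a b)) :
    Subgroup (Quat a b ≃ₗ[K] Quat a b) :=
  G.map (MulAut.conj (Units.mulLeftLinearEquiv K (Quat a b) α)).toMonoidHom

end

end NormalLattice

/-!
The proof rests on two facts.

*Proper isometries.* Every element of `SO(Q, n)` has the form `γ ↦ α γ β⁻¹` with `n(α) = n(β)`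
(`exists_eq_sandwich`). Composing with such maps, an isometry may be assumed to fix `1`, `i` and
`j`; then it multiplies `ij` by its determinant, hence is the identity.

*Stabilisers.* If `n(α) n(β⁻¹)` is a unit, then `α J β⁻¹ = J` if and only if `(α, β) ∈ 𝔑(J)`
(`IsNormal.mem_pairNormalizer_iff`). The lattice `α J β⁻¹` has the norm of `J`, and for
`(α, β) ∈ 𝔑(J)` also the left and right orders of `J`; so it is enough that a normal lattice is
determined by its left order, right order and norm (`IsNormal.eq_of_orders_eq`). This is proved
globally, without localisation or the factorisation theory of two-sided ideals:

* `y` lies in a maximal order `N` as soon as `n(y)` and the traces `t(c y)`, `c ∈ N`, are integral,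
  because then `N + N y N` is a ring (`IsMaximalOrder.mem_of_isIntegral`). Consequently
  `n(J)⁻¹ (star J)` is inverse to a normal lattice `J` (`IsMaximalOrder.smul_star_mul_mem`,
  `mem_of_smul_star_mul_mem`, `smul_mul_star_mem_leftOrder`).
* If `I` and `J` have the same orders and the same norm, put `L = I + J`. Then `L⁻¹ I` and `L⁻¹ J`
  are comaximal two-sided ideals of `N` with the same norm `𝔠`. Writing `1 = e + f` along them gives
  `N = ℤ_K e + ℤ_K f + 𝔠 N`, which contradicts `dim Q = 4` by Nakayama's lemma unless `𝔠 = ℤ_K`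
  (`IsMaximalOrder.eq_top_of_comaximal`). So `I = L = J`.

Given both facts, `α J β⁻¹` and `γ J` are properly isometric exactly when `n(γ)` and
`n(α) n(β⁻¹)` differ by an element of `U(J)`. The conjugation formula for `Aut⁺` only uses that left
multiplication by `α` scales `n`.
-/

namespace NormalLattice

/-! ### Reduced trace and norm -/

section Quaternion

variable {K : Type*} [Field K] {a b : K}

/-- The reduced trace `x + star x`, as a `K`-linear form. -/
def trd : Quat a b →ₗ[K] K where
  toFun x := 2 * x.re
  map_add' x y := by simp [mul_add]
  map_smul' r x := by simp [mul_left_comm]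

theorem trd_apply (x : Quat a b) : trd x = 2 * x.re := rfl

theorem star_eq_trd_smul_sub (x : Quat a b) : star x = trd x • (1 : Quat a b) - x := by
  ext
  · simp [trd_apply]; ring
  all_goals simp [trd_apply]

theorem star_mul_self_eq (x : Quat a b) : star x * x = nrd x • (1 : Quat a b) := by
  ext <;> simp [nrd_eq] <;> ring

theorem mul_star_self_eq (x : Quat a b) : x * star x = nrd x • (1 : Quat a b) := by
  ext <;> simp [nrd_eq] <;> ring

theorem mul_self_eq (x : Quat a b) : x * x = trd x • x - nrd x • (1 : Quat a b) := by
  ext <;> simp [nrd_eq, trd_apply] <;> ring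

theorem nrd_star (x : Quat a b) : nrd (star x) = nrd x := by
  simp [nrd_eq]

theorem nrd_smul (k : K) (x : Quat a b) : nrd (k • x) = k ^ 2 * nrd x := by
  simp [nrd_eq]; ring

theorem trd_mul_comm (x y : Quat a b) : trd (x * y) = trd (y * x) := by
  simp only [trd_apply, QuaternionAlgebra.re_mul]; ring

theorem trd_star_mul (x y : Quat a b) : trd (star x * y) = nrd (x + y) - nrd x - nrd y := by
  simp [trd_apply, nrd_eq]; ring

theorem nrd_one_sub (x : Quat a b) : nrd (1 - x) = 1 - trd x + nrd x := by
  simp [trd_apply, nrd_eq]; ring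

/-- Obtained from `c y = t(c y) - star (c y)` by multiplication with `y` on the left. -/
theorem mul_mul_self_eq (y c : Quat a b) :
    y * c * y = trd (c * y) • y - nrd y • star c := by
  ext <;> simp [trd_apply, nrd_eq] <;> ring

theorem nrd_eq_zero [NumberField K] [NumberField.IsTotallyReal K]
    (ha : TotallyPositive a) (hb : TotallyPositive b) {x : Quat a b} :
    nrd x = 0 ↔ x = 0 := by
  refine ⟨fun h => ?_, fun h => by simp [h]⟩
  obtain ⟨v⟩ := (inferInstance : Nonempty (NumberField.InfinitePlace K))
  have σ : K →+* ℝ :=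
    NumberField.InfinitePlace.embedding_of_isReal (NumberField.IsTotallyReal.isReal v)
  have h1 := ha σ
  have h2 := hb σ
  have h3 := congrArg σ h
  rw [nrd_eq] at h3
  simp only [map_add, map_mul, map_pow, map_zero] at h3
  have p1 : 0 ≤ σ x.re ^ 2 := sq_nonneg _
  have p2 : 0 ≤ σ a * σ x.imI ^ 2 := by positivity
  have p3 : 0 ≤ σ b * σ x.imJ ^ 2 := by positivity
  have p4 : 0 ≤ σ a * σ b * σ x.imK ^ 2 := by positivity
  have q1 : σ x.re ^ 2 = 0 := by linarith
  have q2 : σ a * σ x.imI ^ 2 = 0 := by linarith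
  have q3 : σ b * σ x.imJ ^ 2 = 0 := by linarith
  have q4 : σ a * σ b * σ x.imK ^ 2 = 0 := by linarith
  simp only [mul_eq_zero, h1.ne', h2.ne', false_or, pow_eq_zero_iff, ne_eq, OfNat.ofNat_ne_zero,
    not_false_eq_true, map_eq_zero] at q1 q2 q3 q4
  ext <;> simpa

/-- An element of nonzero reduced norm is invertible. -/
theorem exists_unit_of_nrd_ne_zero {x : Quat a b} (h : nrd x ≠ 0) :
    ∃ u : (Quat a b)ˣ, (u : Quat a b) = x :=
  ⟨⟨x, (nrd x)⁻¹ • star x, by rw [mul_smul_comm, mul_star_self_eq, smul_smul, inv_mul_cancel₀ h,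
    one_smul], by rw [smul_mul_assoc, star_mul_self_eq, smul_smul, inv_mul_cancel₀ h,
    one_smul]⟩, rfl⟩

theorem coe_unitNrd (x : (Quat a b)ˣ) : (unitNrd x : K) = nrd (x : Quat a b) := rfl

open Polynomial in
/-- The reduced trace and norm of an integral quaternion are integral: either the quaternion is a
scalar, or its reduced characteristic polynomial is its minimal polynomial over `K`. -/
theorem isIntegral_trd_nrd {R : Type*} [CommRing R] [IsDomain R] [IsIntegrallyClosed R]
    [Algebra R K] [IsFractionRing R K] {x : Quat a b} (hx : IsIntegral R x) :
    IsIntegral R (trd x) ∧ IsIntegral R (nrd x) := by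
  by_cases hK : ∃ k : K, x = algebraMap K (Quat a b) k
  · obtain ⟨k, rfl⟩ := hK
    have hk : IsIntegral R k :=
      (isIntegral_algHom_iff (IsScalarTower.toAlgHom R K (Quat a b))
        QuaternionAlgebra.algebraMap_injective).1 hx
    have h1 : trd (algebraMap K (Quat a b) k) = k + k := by
      simp [trd_apply, QuaternionAlgebra.algebraMap_eq]; ring
    have h2 : nrd (algebraMap K (Quat a b) k) = k * k := by
      simp [nrd_eq, QuaternionAlgebra.algebraMap_eq]; ring
    rw [h1, h2]
    exact ⟨hk.add hk, hk.mul hk⟩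
  · obtain ⟨p, hp, hpx⟩ := hx
    set g : K[X] := X ^ 2 - C (trd x) * X + C (nrd x) with hg
    have hdeg : (- C (trd x) * X + C (nrd x)).degree < ((2 : ℕ) : WithBot ℕ) := by
      refine lt_of_le_of_lt ?_ (by norm_num : ((1 : ℕ) : WithBot ℕ) < ((2 : ℕ) : WithBot ℕ))
      rw [← C_neg]
      exact degree_linear_le
    have hgm : g.Monic := by
      have : g = X ^ 2 + (- C (trd x) * X + C (nrd x)) := by rw [hg]; ring
      rw [this]
      exact monic_X_pow_add hdeg
    have hgd : g.degree = 2 := by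
      have : g = X ^ 2 + (- C (trd x) * X + C (nrd x)) := by rw [hg]; ring
      rw [this]
      rw [degree_add_eq_left_of_degree_lt (by rwa [degree_X_pow]), degree_X_pow]
      rfl
    have hgx : aeval x g = 0 := by
      simp only [hg, map_add, map_sub, map_mul, aeval_X, aeval_C, sq, mul_self_eq,
        Algebra.algebraMap_eq_smul_one, smul_mul_assoc, one_mul]
      abel
    have hdvd : g ∣ p.map (algebraMap R K) := by
      rw [← modByMonic_eq_zero_iff_dvd hgm]
      set r := p.map (algebraMap R K) %ₘ g with hr
      have hrx : aeval x r = 0 := by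
        rw [hr, modByMonic_eq_sub_mul_div, map_sub, map_mul, hgx, zero_mul, sub_zero,
          aeval_map_algebraMap]
        exact hpx
      have hrd : r.degree ≤ 1 := by
        have := degree_modByMonic_lt (p.map (algebraMap R K)) hgm
        rw [hgd] at this
        exact Order.le_of_lt_succ this
      rw [eq_X_add_C_of_degree_le_one hrd] at hrx ⊢
      simp only [map_add, map_mul, aeval_X, aeval_C] at hrx
      have h1 : r.coeff 1 = 0 := by
        by_contra h
        refine hK ⟨-((r.coeff 1)⁻¹ * r.coeff 0), ?_⟩
        rw [← Algebra.smul_def] at hrx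
        have : (r.coeff 1)⁻¹ • (r.coeff 1 • x) =
            (r.coeff 1)⁻¹ • (-(algebraMap K (Quat a b) (r.coeff 0))) := by
          rw [eq_neg_of_add_eq_zero_left hrx]
        rw [smul_smul, inv_mul_cancel₀ h, one_smul] at this
        rw [this, smul_neg, map_neg, map_mul, ← Algebra.smul_def]
      have h0 : r.coeff 0 = 0 := by
        rw [h1, map_zero, zero_mul, zero_add] at hrx
        exact QuaternionAlgebra.algebraMap_injective (hrx.trans (map_zero _).symm)
      simp [h1, h0]
    obtain ⟨q, hq⟩ := IsIntegrallyClosed.eq_map_mul_C_of_dvd K hp hdvd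
    rw [hgm.leadingCoeff, C_1, mul_one] at hq
    have c0 : g.coeff 0 = nrd x := by simp [hg]
    have c1 : g.coeff 1 = - trd x := by simp [hg, coeff_C]
    rw [← hq, coeff_map] at c0 c1
    refine ⟨?_, c0 ▸ isIntegral_algebraMap⟩
    rw [← neg_neg (trd x), ← c1]
    exact isIntegral_algebraMap.neg

end Quaternion

/-! ### Proper isometries of the norm form -/

section Isometry

variable {K : Type*} [Field K] {a b : K}

open QuaternionAlgebra in
theorem det_eq_det_coordinates (f : Quat a b →ₗ[K] Quat a b) : LinearMap.det f = Matrix.det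
    !![(f ⟨1, 0, 0, 0⟩).re, (f ⟨0, 1, 0, 0⟩).re, (f ⟨0, 0, 1, 0⟩).re, (f ⟨0, 0, 0, 1⟩).re;
       (f ⟨1, 0, 0, 0⟩).imI, (f ⟨0, 1, 0, 0⟩).imI, (f ⟨0, 0, 1, 0⟩).imI, (f ⟨0, 0, 0, 1⟩).imI;
       (f ⟨1, 0, 0, 0⟩).imJ, (f ⟨0, 1, 0, 0⟩).imJ, (f ⟨0, 0, 1, 0⟩).imJ, (f ⟨0, 0, 0, 1⟩).imJ;
       (f ⟨1, 0, 0, 0⟩).imK, (f ⟨0, 1, 0, 0⟩).imK, (f ⟨0, 0, 1, 0⟩).imK, (f ⟨0, 0, 0, 1⟩).imK] := by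
  rw [← LinearMap.det_toMatrix (basisOneIJK (-a) 0 (-b))]
  congr 1
  have h0 : basisOneIJK (-a) 0 (-b) 0 = ⟨1, 0, 0, 0⟩ := by
    ext <;> simp [basisOneIJK]
  have h1 : basisOneIJK (-a) 0 (-b) 1 = ⟨0, 1, 0, 0⟩ := by
    ext <;> simp [basisOneIJK]
  have h2 : basisOneIJK (-a) 0 (-b) 2 = ⟨0, 0, 1, 0⟩ := by
    ext <;> simp [basisOneIJK]
  have h3 : basisOneIJK (-a) 0 (-b) 3 = ⟨0, 0, 0, 1⟩ := by
    ext <;> simp [basisOneIJK]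
  ext i j
  rw [LinearMap.toMatrix_apply, coe_basisOneIJK_repr]
  fin_cases j <;> fin_cases i <;> simp [h0, h1, h2, h3]

theorem det_mulLeft (x : Quat a b) : LinearMap.det (LinearMap.mulLeft K x) = nrd x ^ 2 := by
  rw [det_eq_det_coordinates]
  simp [Matrix.det_succ_row_zero, Fin.sum_univ_succ, Fin.succAbove, nrd_eq]
  ring

theorem det_mulRight (x : Quat a b) : LinearMap.det (LinearMap.mulRight K x) = nrd x ^ 2 := by
  rw [det_eq_det_coordinates]
  simp [Matrix.det_succ_row_zero, Fin.sum_univ_succ, Fin.succAbove, nrd_eq]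
  ring

/-- The automorphism `γ ↦ α γ β⁻¹` of `Q`, for `α, β ∈ Q^*`. -/
def sandwich (α β : (Quat a b)ˣ) : Quat a b ≃ₗ[K] Quat a b :=
  LinearEquiv.ofLinearMap
    (LinearMap.mulLeftRight K ((α : Quat a b), ((β⁻¹ : (Quat a b)ˣ) : Quat a b)))
    (LinearMap.mulLeftRight K (((α⁻¹ : (Quat a b)ˣ) : Quat a b), (β : Quat a b)))
    (by ext1 x; simp [LinearMap.mulLeftRight_apply, mul_assoc])
    (by ext1 x; simp [LinearMap.mulLeftRight_apply, mul_assoc])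

theorem sandwich_apply (α β : (Quat a b)ˣ) (x : Quat a b) :
    sandwich α β x = α * x * ((β⁻¹ : (Quat a b)ˣ) : Quat a b) := rfl

theorem sandwich_mul (α β α' β' : (Quat a b)ˣ) :
    sandwich α β * sandwich α' β' = sandwich (α * α') (β * β') := by
  ext1 x
  simp [LinearEquiv.mul_apply, sandwich_apply, mul_assoc]

theorem sandwich_mem_properIsometries {α β : (Quat a b)ˣ} (h : unitNrd α = unitNrd β) :
    sandwich α β ∈ properIsometries a b := by
  have h' : nrd (α : Quat a b) * nrd ((β⁻¹ : (Quat a b)ˣ) : Quat a b) = 1 := by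
    rw [← coe_unitNrd, ← coe_unitNrd, h, map_inv, ← Units.val_mul, mul_inv_cancel, Units.val_one]
  refine ⟨fun x => ?_, ?_⟩
  · rw [sandwich_apply, map_mul, map_mul, mul_right_comm, h', one_mul]
  · ext1
    rw [LinearEquiv.coe_det, Units.val_one]
    have : ((sandwich α β : Quat a b ≃ₗ[K] Quat a b) : Quat a b →ₗ[K] Quat a b) =
        LinearMap.mulLeft K (α : Quat a b) ∘ₗ
          LinearMap.mulRight K ((β⁻¹ : (Quat a b)ˣ) : Quat a b) := by
      ext1 x
      simp [sandwich_apply, mul_assoc]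
    rw [this, LinearMap.det_comp, det_mulLeft, det_mulRight, ← mul_pow, h', one_pow]

theorem trd_star_mul_map {φ : Quat a b ≃ₗ[K] Quat a b} (hφ : ∀ x, nrd (φ x) = nrd x)
    (x y : Quat a b) : trd (star (φ x) * φ y) = trd (star x * y) := by
  rw [trd_star_mul, trd_star_mul, ← map_add, hφ, hφ, hφ]

theorem one_eq_mk : (1 : Quat a b) = ⟨1, 0, 0, 0⟩ := rfl

section Char

variable [CharZero K]

/-- A proper isometry that fixes `1`, `i` and `j` sends `ij` to a multiple of itself; this multiple
is the determinant. -/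
theorem eq_one_of_fixes (ha : a ≠ 0) (hb : b ≠ 0) {φ : Quat a b ≃ₗ[K] Quat a b}
    (hφ : φ ∈ properIsometries a b) (h0 : φ ⟨1, 0, 0, 0⟩ = ⟨1, 0, 0, 0⟩)
    (h1 : φ ⟨0, 1, 0, 0⟩ = ⟨0, 1, 0, 0⟩) (h2 : φ ⟨0, 0, 1, 0⟩ = ⟨0, 0, 1, 0⟩) : φ = 1 := by
  obtain ⟨p, q, r, s, hk⟩ : ∃ p q r s, φ ⟨0, 0, 0, 1⟩ = ⟨p, q, r, s⟩ := ⟨_, _, _, _, rfl⟩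
  have e0 := trd_star_mul_map hφ.1 ⟨1, 0, 0, 0⟩ ⟨0, 0, 0, 1⟩
  have e1 := trd_star_mul_map hφ.1 ⟨0, 1, 0, 0⟩ ⟨0, 0, 0, 1⟩
  have e2 := trd_star_mul_map hφ.1 ⟨0, 0, 1, 0⟩ ⟨0, 0, 0, 1⟩
  rw [h0, hk] at e0
  rw [h1, hk] at e1
  rw [h2, hk] at e2
  simp [trd_apply] at e0
  simp [trd_apply, ha] at e1
  simp [trd_apply, hb] at e2
  subst e0 e1 e2
  have hd := congrArg Units.val hφ.2
  rw [LinearEquiv.coe_det, Units.val_one, det_eq_det_coordinates] at hd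
  simp only [LinearEquiv.coe_coe, h0, h1, h2, hk] at hd
  simp [Matrix.det_succ_row_zero, Fin.sum_univ_succ, Fin.succAbove] at hd
  subst hd
  ext1 x
  have hx : x = x.re • ⟨1, 0, 0, 0⟩ + x.imI • ⟨0, 1, 0, 0⟩ + x.imJ • ⟨0, 0, 1, 0⟩ +
      x.imK • ⟨0, 0, 0, 1⟩ := by
    ext <;> simp
  rw [hx]
  simp only [map_add, map_smul, h0, h1, h2, hk, LinearEquiv.coe_one, id]

/-- A norm-preserving automorphism fixing `1` moves `i` to one of its conjugates `i'`:
`i + i'` conjugates `i` to `i'` unless `i' = -i`, and then `j` does. -/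
theorem exists_conj_I (hb : b ≠ 0) (hQ : ∀ x : Quat a b, x ≠ 0 → nrd x ≠ 0)
    {φ : Quat a b ≃ₗ[K] Quat a b}
    (hφ : φ ∈ properIsometries a b) (h0 : φ ⟨1, 0, 0, 0⟩ = ⟨1, 0, 0, 0⟩) :
    ∃ c : (Quat a b)ˣ, (c : Quat a b) * ⟨0, 1, 0, 0⟩ = φ ⟨0, 1, 0, 0⟩ * c := by
  obtain ⟨p, q, r, s, hk⟩ : ∃ p q r s, φ ⟨0, 1, 0, 0⟩ = ⟨p, q, r, s⟩ := ⟨_, _, _, _, rfl⟩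
  have e0 := trd_star_mul_map hφ.1 ⟨1, 0, 0, 0⟩ ⟨0, 1, 0, 0⟩
  have e1 := hφ.1 ⟨0, 1, 0, 0⟩
  rw [h0, hk] at e0
  rw [hk] at e1
  simp [trd_apply] at e0
  subst e0
  simp [nrd_eq] at e1
  rw [hk]
  by_cases h : (⟨0, 1, 0, 0⟩ + ⟨0, q, r, s⟩ : Quat a b) = 0
  · obtain ⟨c, hc⟩ := exists_unit_of_nrd_ne_zero (a := a) (b := b) (x := ⟨0, 0, 1, 0⟩)
      (by simpa [nrd_eq] using hb)
    have : (⟨0, q, r, s⟩ : Quat a b) = ⟨0, -1, 0, 0⟩ := by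
      rw [← neg_eq_of_add_eq_zero_right h]; ext <;> simp
    refine ⟨c, ?_⟩
    rw [hc, this]
    ext <;> simp
  · obtain ⟨c, hc⟩ := exists_unit_of_nrd_ne_zero (hQ _ h)
    refine ⟨c, ?_⟩
    rw [hc]
    ext <;> simp <;> first | ring1 | linear_combination e1

/-- A norm-preserving automorphism fixing `1` and `i` moves `j` to a conjugate `j'` under the
centraliser of `i`: `(j + j') j` conjugates `j` to `j'` unless `j' = -j`, and then `i` does. -/
theorem exists_conj_J (ha : a ≠ 0) (hb : b ≠ 0) (hQ : ∀ x : Quat a b, x ≠ 0 → nrd x ≠ 0)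
    {φ : Quat a b ≃ₗ[K] Quat a b}
    (hφ : φ ∈ properIsometries a b) (h0 : φ ⟨1, 0, 0, 0⟩ = ⟨1, 0, 0, 0⟩)
    (h1 : φ ⟨0, 1, 0, 0⟩ = ⟨0, 1, 0, 0⟩) :
    ∃ c : (Quat a b)ˣ, (c : Quat a b) * ⟨0, 1, 0, 0⟩ = ⟨0, 1, 0, 0⟩ * c ∧
      (c : Quat a b) * ⟨0, 0, 1, 0⟩ = φ ⟨0, 0, 1, 0⟩ * c := by
  obtain ⟨p, q, r, s, hk⟩ : ∃ p q r s, φ ⟨0, 0, 1, 0⟩ = ⟨p, q, r, s⟩ := ⟨_, _, _, _, rfl⟩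
  have e0 := trd_star_mul_map hφ.1 ⟨1, 0, 0, 0⟩ ⟨0, 0, 1, 0⟩
  have e1 := trd_star_mul_map hφ.1 ⟨0, 1, 0, 0⟩ ⟨0, 0, 1, 0⟩
  have e2 := hφ.1 ⟨0, 0, 1, 0⟩
  rw [h0, hk] at e0
  rw [h1, hk] at e1
  rw [hk] at e2
  simp [trd_apply] at e0
  simp [trd_apply, ha] at e1
  subst e0 e1
  simp [nrd_eq] at e2
  rw [hk]
  by_cases h : (⟨0, 0, 1, 0⟩ + ⟨0, 0, r, s⟩ : Quat a b) = 0
  · obtain ⟨c, hc⟩ := exists_unit_of_nrd_ne_zero (a := a) (b := b) (x := ⟨0, 1, 0, 0⟩)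
      (by simpa [nrd_eq] using ha)
    have : (⟨0, 0, r, s⟩ : Quat a b) = ⟨0, 0, -1, 0⟩ := by
      rw [← neg_eq_of_add_eq_zero_right h]; ext <;> simp
    refine ⟨c, ?_, ?_⟩
    · rw [hc]
    · rw [hc, this]
      ext <;> simp
  · have hj : nrd (⟨0, 0, 1, 0⟩ : Quat a b) ≠ 0 := by simpa [nrd_eq] using hb
    obtain ⟨c, hc⟩ := exists_unit_of_nrd_ne_zero
      (x := (⟨0, 0, 1, 0⟩ + ⟨0, 0, r, s⟩ : Quat a b) * ⟨0, 0, 1, 0⟩)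
      (by rw [map_mul]; exact mul_ne_zero (hQ _ h) hj)
    refine ⟨c, ?_, ?_⟩
    · rw [hc]
      ext <;> simp
    · rw [hc]
      ext <;> simp <;> first | linear_combination e2 | ring

end Char

section TotallyReal

variable [NumberField K] [NumberField.IsTotallyReal K]

theorem TotallyPositive.ne_zero {k : K} (hk : TotallyPositive k) : k ≠ 0 := by
  rintro rfl
  obtain ⟨v⟩ := (inferInstance : Nonempty (NumberField.InfinitePlace K))
  simpa using hk (NumberField.InfinitePlace.embedding_of_isReal
    (NumberField.IsTotallyReal.isReal v))

/-- Every proper isometry of `(Q, n)` has the form `γ ↦ α γ β⁻¹` with `n(α) = n(β)`. A left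
multiplication reduces to the case that `1` is fixed; conjugations then make `i` and `j` fixed. -/
theorem exists_eq_sandwich (ha : TotallyPositive a) (hb : TotallyPositive b)
    {φ : Quat a b ≃ₗ[K] Quat a b} (hφ : φ ∈ properIsometries a b) :
    ∃ α β : (Quat a b)ˣ, unitNrd α = unitNrd β ∧ φ = sandwich α β := by
  have hQ : ∀ x : Quat a b, x ≠ 0 → nrd x ≠ 0 := fun x hx h => hx ((nrd_eq_zero ha hb).1 h)
  have hinv : ∀ {ψ χ : Quat a b ≃ₗ[K] Quat a b} {x y : Quat a b}, ψ x = χ y →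
      (χ⁻¹ * ψ) x = y := fun {ψ χ x y} h => by
    rw [LinearEquiv.mul_apply, h]
    exact χ.symm_apply_apply y
  have hconj : ∀ (c : (Quat a b)ˣ) {x y : Quat a b}, (c : Quat a b) * x = y * c →
      y = sandwich c c x := fun c x y h => by
    rw [sandwich_apply, h, mul_assoc, Units.mul_inv, mul_one]
  obtain ⟨α, hα⟩ := exists_unit_of_nrd_ne_zero (x := φ 1) (by rw [hφ.1, map_one]; exact one_ne_zero)
  have hα1 : unitNrd α = unitNrd (1 : (Quat a b)ˣ) := by
    ext1
    rw [coe_unitNrd, hα, hφ.1, map_one, map_one, Units.val_one]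
  have hψ : (sandwich α 1)⁻¹ * φ ∈ properIsometries a b :=
    mul_mem (inv_mem (sandwich_mem_properIsometries hα1)) hφ
  have hψ0 : ((sandwich α 1)⁻¹ * φ) ⟨1, 0, 0, 0⟩ = ⟨1, 0, 0, 0⟩ := by
    refine hinv ?_
    rw [← one_eq_mk, sandwich_apply, hα]
    simp
  set ψ := (sandwich α 1)⁻¹ * φ with hψ_def
  obtain ⟨c, hc⟩ := exists_conj_I hb.ne_zero hQ hψ hψ0
  have hχ : (sandwich c c)⁻¹ * ψ ∈ properIsometries a b :=
    mul_mem (inv_mem (sandwich_mem_properIsometries rfl)) hψ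
  have hχ0 : ((sandwich c c)⁻¹ * ψ) ⟨1, 0, 0, 0⟩ = ⟨1, 0, 0, 0⟩ :=
    hinv (hψ0.trans (hconj c (by rw [← one_eq_mk, one_mul, mul_one])))
  have hχ1 : ((sandwich c c)⁻¹ * ψ) ⟨0, 1, 0, 0⟩ = ⟨0, 1, 0, 0⟩ := hinv (hconj c hc)
  set χ := (sandwich c c)⁻¹ * ψ with hχ_def
  obtain ⟨d, hd1, hd2⟩ := exists_conj_J ha.ne_zero hb.ne_zero hQ hχ hχ0 hχ1
  have hω : (sandwich d d)⁻¹ * χ = 1 := by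
    refine eq_one_of_fixes ha.ne_zero hb.ne_zero
      (mul_mem (inv_mem (sandwich_mem_properIsometries rfl)) hχ) ?_ ?_ ?_
    · exact hinv (hχ0.trans (hconj d (by rw [← one_eq_mk, one_mul, mul_one])))
    · exact hinv (hχ1.trans (hconj d hd1))
    · exact hinv (hconj d hd2)
  refine ⟨α * c * d, 1 * c * d, by rw [map_mul, map_mul, hα1, map_mul, map_mul], ?_⟩
  rw [← sandwich_mul, ← sandwich_mul]
  rw [inv_mul_eq_one] at hω
  rw [hω, hχ_def, hψ_def]
  group

end TotallyReal

end Isometry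

/-! ### Integrality and maximal orders -/

section Adjoin

/-- If `y N y ⊆ N y + N`, then `N + N y N` is a ring. -/
theorem exists_subalgebra_of_mul_mul_self {R A : Type*} [CommRing R] [Ring A] [Algebra R A]
    {N : Subalgebra R A} (hN : (Subalgebra.toSubmodule N).FG) (y : A)
    (h : ∀ c ∈ N, ∃ u ∈ N, ∃ v ∈ N, y * c * y = u * y + v) :
    ∃ W : Subalgebra R A, N ≤ W ∧ y ∈ W ∧ (Subalgebra.toSubmodule W).FG := by
  set n := Subalgebra.toSubmodule N with hn_def
  set Y := Submodule.span R {y} with hY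
  have hnn : n * n = n := N.isIdempotentElem_toSubmodule
  have hmem : ∀ u ∈ N, u * y ∈ n * Y * n := fun u hu => by
    have := Submodule.mul_mem_mul (Submodule.mul_mem_mul (show u ∈ n from hu)
      (Submodule.mem_span_singleton_self (R := R) y)) (show (1 : A) ∈ n from one_mem N)
    rwa [mul_one] at this
  have hYnY : Y * n * Y ≤ n + n * Y * n := by
    refine Submodule.mul_le.2 fun m hm z hz => ?_
    obtain ⟨r, rfl⟩ := Submodule.mem_span_singleton.1 hz
    rw [mul_smul_comm]
    refine Submodule.smul_mem _ _ ?_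
    refine Submodule.mul_induction_on hm (fun u hu c hc => ?_) fun u v hu hv => ?_
    · obtain ⟨r', rfl⟩ := Submodule.mem_span_singleton.1 hu
      obtain ⟨u, hu, v, hv, e⟩ := h c hc
      rw [smul_mul_assoc, smul_mul_assoc, e]
      exact Submodule.smul_mem _ _ (add_mem (Submodule.mem_sup_right (hmem u hu))
        (Submodule.mem_sup_left hv))
    · rw [add_mul]
      exact add_mem hu hv
  have hnW : n ≤ n + n * Y * n := le_sup_left
  have hWW : (n + n * Y * n) * (n + n * Y * n) ≤ n + n * Y * n := by
    have e : (n + n * Y * n) * (n + n * Y * n) = n * n + (n * n) * Y * n + n * Y * (n * n) +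
        n * (Y * (n * n) * Y) * n := by
      simp only [add_mul, mul_add, mul_assoc]
      abel
    have e2 : n * (n + n * Y * n) * n = n + n * Y * n := by
      calc n * (n + n * Y * n) * n = (n * n) * n + (n * n) * Y * (n * n) := by
            simp only [add_mul, mul_add, mul_assoc]
        _ = n + n * Y * n := by rw [hnn, hnn]
    rw [e, hnn]
    refine sup_le (sup_le (sup_le hnW le_sup_right) le_sup_right) ?_
    exact (mul_le_mul' (mul_le_mul' le_rfl hYnY) le_rfl).trans e2.le
  refine ⟨(n + n * Y * n).toSubalgebra (hnW (one_mem N))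
    (fun x y hx hy => hWW (Submodule.mul_mem_mul hx hy)), hnW, ?_, ?_⟩
  · have := hmem 1 (one_mem N)
    rw [one_mul] at this
    exact Submodule.mem_sup_right this
  · rw [Submodule.toSubalgebra_toSubmodule]
    exact hN.sup ((hN.mul (Submodule.fg_span_singleton y)).mul hN)

end Adjoin

section Integrality

variable {K : Type*} [Field K] {a b : K}

instance : IsScalarTower (𝓞 K) (Quat a b) (Quat a b) :=
  ⟨fun r x y => by
    rw [smul_eq_mul, smul_eq_mul, ← algebraMap_smul K r x, ← algebraMap_smul K r (x * y),
      smul_mul_assoc]⟩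

instance : SMulCommClass (𝓞 K) (Quat a b) (Quat a b) :=
  ⟨fun r x y => by
    rw [smul_eq_mul, smul_eq_mul, ← algebraMap_smul K r y, ← algebraMap_smul K r (x * y),
      mul_smul_comm]⟩

/-- The additive group of a subalgebra, as a submodule for the coordinatewise `ℤ_K`-module
structure of `Q`. This structure agrees with the one underlying the `ℤ_K`-algebra structure only
after unfolding, and typeclass search does not identify the two. -/
def toLattice (N : Subalgebra (𝓞 K) (Quat a b)) : Submodule (𝓞 K) (Quat a b) :=
  Subalgebra.toSubmodule N

theorem smul_mem_of_isIntegral [NumberField K] {V : Type*} [AddCommGroup V] [Module (𝓞 K) V]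
    [Module K V] [IsScalarTower (𝓞 K) K V] {k : K} (hk : IsIntegral (𝓞 K) k)
    (L : Submodule (𝓞 K) V) {x : V} (hx : x ∈ L) : k • x ∈ L := by
  obtain ⟨r, rfl⟩ := IsIntegrallyClosed.isIntegral_iff.1 hk
  rw [algebraMap_smul]
  exact L.smul_mem r hx

/-- A finitely generated nonzero `ℤ_K`-submodule of `K` is invertible, expressed through a
generating set `T`. -/
theorem one_mem_span_inv_mul [NumberField K] {T : Set K}
    (hT : IsFractional (𝓞 K)⁰ (Submodule.span (𝓞 K) T)) (h0 : ∃ t ∈ T, t ≠ 0) :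
    (1 : K) ∈ Submodule.span (𝓞 K)
      {k | ∃ s, (∀ t ∈ T, IsIntegral (𝓞 K) (s * t)) ∧ ∃ t ∈ T, k = s * t} := by
  set F : FractionalIdeal (𝓞 K)⁰ K := ⟨Submodule.span (𝓞 K) T, hT⟩ with hF
  have hTF : ∀ t ∈ T, t ∈ F := fun t ht => Submodule.subset_span ht
  have hF0 : F ≠ 0 := by
    obtain ⟨t, ht, ht0⟩ := h0
    intro h
    exact ht0 ((FractionalIdeal.mem_zero_iff _).1 (h ▸ hTF t ht))
  have h1 : (1 : K) ∈ F⁻¹ * F := by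
    rw [inv_mul_cancel₀ hF0]
    exact FractionalIdeal.one_mem_one _
  rw [← FractionalIdeal.mem_coe, FractionalIdeal.coe_mul] at h1
  refine Submodule.mul_induction_on h1 (fun s hs t ht => ?_) (fun _ _ => add_mem)
  have hs' : ∀ t ∈ T, IsIntegral (𝓞 K) (s * t) := fun t ht => by
    obtain ⟨r, hr⟩ := (FractionalIdeal.mem_one_iff _).1
      ((FractionalIdeal.mem_inv_iff hF0).1 hs t (hTF t ht))
    rw [← hr]
    exact isIntegral_algebraMap
  change t ∈ Submodule.span (𝓞 K) T at ht
  induction ht using Submodule.span_induction with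
  | mem t ht => exact Submodule.subset_span ⟨s, hs', t, ht, rfl⟩
  | zero => rw [mul_zero]; exact zero_mem _
  | add x y hx hy h1 h2 => rw [mul_add]; exact add_mem h1 h2
  | smul r x hx h => rw [mul_smul_comm]; exact Submodule.smul_mem _ r h

/-- The norm of a lattice is generated by the norms and the polar products of generators. -/
theorem latticeNorm_isFractional [NumberField K] {J : Submodule (𝓞 K) (Quat a b)} (hJ : J.FG) :
    IsFractional (𝓞 K)⁰ (latticeNorm J) := by
  obtain ⟨S, rfl⟩ := hJ
  set T : Set K := (fun x => nrd x) '' (S : Set (Quat a b)) ∪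
    (fun p : Quat a b × Quat a b => trd (star p.1 * p.2)) '' ((S : Set (Quat a b)) ×ˢ S) with hT
  have hTfin : T.Finite :=
    (S.finite_toSet.image _).union ((S.finite_toSet.prod S.finite_toSet).image _)
  have hB : ∀ x ∈ Submodule.span (𝓞 K) (S : Set (Quat a b)),
      ∀ y ∈ Submodule.span (𝓞 K) (S : Set (Quat a b)),
      trd (star x * y) ∈ Submodule.span (𝓞 K) T := by
    intro x hx y hy
    induction hx, hy using Submodule.span_induction₂ with
    | mem_mem x y hx hy => exact Submodule.subset_span (Or.inr ⟨(x, y), ⟨hx, hy⟩, rfl⟩)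
    | zero_left y hy => simp
    | zero_right x hx => simp
    | add_left x y z hx hy hz h1 h2 => rw [star_add, add_mul, map_add]; exact add_mem h1 h2
    | add_right x y z hx hy hz h1 h2 => rw [mul_add, map_add]; exact add_mem h1 h2
    | smul_left r x y hx hy h =>
      rw [← algebraMap_smul K r x, QuaternionAlgebra.star_smul', smul_mul_assoc, map_smul,
        algebraMap_smul]
      exact Submodule.smul_mem _ _ h
    | smul_right r x y hx hy h =>
      rw [← algebraMap_smul K r y, mul_smul_comm, map_smul, algebraMap_smul]
      exact Submodule.smul_mem _ _ h
  have hn : latticeNorm (Submodule.span (𝓞 K) (S : Set (Quat a b))) ≤ Submodule.span (𝓞 K) T := by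
    refine Submodule.span_le.2 ?_
    rintro _ ⟨x, hx, rfl⟩
    change x ∈ Submodule.span (𝓞 K) (S : Set (Quat a b)) at hx
    change nrd x ∈ Submodule.span (𝓞 K) T
    induction hx using Submodule.span_induction with
    | mem x hx => exact Submodule.subset_span (Or.inl ⟨x, hx, rfl⟩)
    | zero => rw [map_zero]; exact zero_mem _
    | add x y hx hy h1 h2 =>
      have h := trd_star_mul x y
      rw [show nrd (x + y) = nrd x + nrd y + trd (star x * y) by rw [h]; ring]
      exact add_mem (add_mem h1 h2) (hB x hx y hy)
    | smul r x hx h =>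
      rw [← algebraMap_smul K r x, nrd_smul, ← map_pow, ← Algebra.smul_def]
      exact Submodule.smul_mem _ _ h
  exact FractionalIdeal.isFractional_of_le
    (J := ⟨_, FractionalIdeal.isFractional_of_fg (Submodule.fg_span hTfin)⟩) hn

theorem exists_mem_ne_zero {J : Submodule (𝓞 K) (Quat a b)} (hJ : Submodule.IsLattice K J) :
    ∃ x ∈ J, x ≠ 0 := by
  by_contra! h
  have h1 := hJ.span_eq_top
  rw [show (J : Set (Quat a b)) = {0} from Set.eq_singleton_iff_unique_mem.2 ⟨J.zero_mem, h⟩,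
    Submodule.span_zero_singleton] at h1
  exact bot_ne_top h1

end Integrality

section Orders

variable {K : Type*} [Field K] [NumberField K] {a b : K}

theorem isIntegral_of_mem_fg {S : Subalgebra (𝓞 K) (Quat a b)}
    (hS : (toLattice S).FG) {x : Quat a b} (hx : x ∈ S) :
    IsIntegral (𝓞 K) (trd x) ∧ IsIntegral (𝓞 K) (nrd x) :=
  isIntegral_trd_nrd (IsIntegral.of_mem_of_fg S hS x hx)

theorem star_mem_of_fg {S : Subalgebra (𝓞 K) (Quat a b)}
    (hS : (toLattice S).FG) {x : Quat a b} (hx : x ∈ S) : star x ∈ S := by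
  rw [star_eq_trd_smul_sub]
  exact sub_mem (smul_mem_of_isIntegral (isIntegral_of_mem_fg hS hx).1
    (toLattice S) (one_mem S)) hx

/-- A criterion for membership in a maximal order `N`. As `y c y = t(c y) y - n(y) star c`, the
submodule `N + N y N` is a ring, hence an order containing `N`. -/
theorem IsMaximalOrder.mem_of_isIntegral {N : Subalgebra (𝓞 K) (Quat a b)} (hN : IsMaximalOrder N)
    {y : Quat a b} (hn : IsIntegral (𝓞 K) (nrd y))
    (ht : ∀ c ∈ N, IsIntegral (𝓞 K) (trd (c * y))) : y ∈ N := by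
  have hfg : (toLattice N).FG := hN.prop.fg
  obtain ⟨W, hNW, hyW, hWfg⟩ := exists_subalgebra_of_mul_mul_self hfg y fun c hc =>
    ⟨trd (c * y) • 1, smul_mem_of_isIntegral (ht c hc) (toLattice N) (one_mem N),
      -(nrd y • star c), neg_mem (smul_mem_of_isIntegral hn (toLattice N)
        (star_mem_of_fg hfg hc)), by
      rw [mul_mul_self_eq, smul_mul_assoc, one_mul, sub_eq_add_neg]⟩
  have hNl : Submodule.IsLattice K (toLattice N) := hN.prop
  have hWl : Submodule.IsLattice K (toLattice W) :=
    Submodule.IsLattice.of_le_of_isLattice_of_fg K (M := toLattice N) (N := toLattice W) hNW hWfg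
  have hWo : IsOrder W := hWl
  exact hN.le_of_ge hWo hNW hyW

/-- If `s n(J) ⊆ ℤ_K` for a right module `J` over a maximal order `N`, then `s (star J) J ⊆ N`. -/
theorem IsMaximalOrder.smul_star_mul_mem {N : Subalgebra (𝓞 K) (Quat a b)} (hN : IsMaximalOrder N)
    {J : Submodule (𝓞 K) (Quat a b)} (hJN : ∀ x ∈ J, ∀ c ∈ N, x * c ∈ J) {s : K}
    (hs : ∀ x ∈ J, IsIntegral (𝓞 K) (s * nrd x)) {x y : Quat a b} (hx : x ∈ J) (hy : y ∈ J) :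
    s • (star x * y) ∈ N := by
  refine hN.mem_of_isIntegral ?_ fun c hc => ?_
  · have h1 : nrd (s • (star x * y)) = s * nrd x * (s * nrd y) := by
      rw [nrd_smul, map_mul, nrd_star]
      ring
    rw [h1]
    exact (hs x hx).mul (hs y hy)
  · have h1 : s * nrd (x + y * c) - s * nrd x - s * nrd (y * c) =
        trd (c * s • (star x * y)) := by
      rw [trd_mul_comm, smul_mul_assoc, map_smul, mul_assoc, trd_star_mul, smul_eq_mul]
      ring
    rw [← h1]
    exact ((hs _ (add_mem hx (hJN y hy c hc))).sub (hs x hx)).sub (hs _ (hJN y hy c hc))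

end Orders

/-! ### Inverses of normal lattices -/

section NormDual

variable {K : Type*} [Field K] {a b : K}

theorem isIntegral_mul_nrd_iff {J : Submodule (𝓞 K) (Quat a b)} {s : K} :
    (∀ x ∈ J, IsIntegral (𝓞 K) (s * nrd x)) ↔ ∀ k ∈ latticeNorm J, IsIntegral (𝓞 K) (s * k) := by
  refine ⟨fun h k hk => ?_, fun h x hx => h _ (Submodule.subset_span ⟨x, hx, rfl⟩)⟩
  induction hk using Submodule.span_induction with
  | mem k hk => obtain ⟨x, hx, rfl⟩ := hk; exact h x hx
  | zero => rw [mul_zero]; exact isIntegral_zero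
  | add x y _ _ h1 h2 => rw [mul_add]; exact h1.add h2
  | smul r x _ h1 => rw [mul_smul_comm]; exact h1.smul r

end NormDual

section NormalLattices

variable {K : Type*} [Field K] [NumberField K] {a b : K}

theorem leftOrder_fg (hQ : ∀ x : Quat a b, x ≠ 0 → nrd x ≠ 0) {J : Submodule (𝓞 K) (Quat a b)}
    (hJ : Submodule.IsLattice K J) : (toLattice (leftOrder J)).FG := by
  obtain ⟨x, hx, hx0⟩ := exists_mem_ne_zero hJ
  obtain ⟨u, rfl⟩ := exists_unit_of_nrd_ne_zero (hQ x hx0)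
  have : IsNoetherian (𝓞 K) J := isNoetherian_of_fg_of_noetherian J hJ.fg
  let f : toLattice (leftOrder J) →ₗ[𝓞 K] J :=
    { toFun := fun m => ⟨m.1 * u, m.2 _ hx⟩
      map_add' := fun m m' => Subtype.ext (add_mul _ _ _)
      map_smul' := fun r m => Subtype.ext (smul_mul_assoc r m.1 (u : Quat a b)) }
  have hf : Function.Injective f := fun m m' h =>
    Subtype.ext (u.isUnit.mul_left_injective (congrArg Subtype.val h))
  exact Module.Finite.iff_fg.1 (Module.Finite.of_injective f hf)

theorem rightOrder_fg (hQ : ∀ x : Quat a b, x ≠ 0 → nrd x ≠ 0) {J : Submodule (𝓞 K) (Quat a b)}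
    (hJ : Submodule.IsLattice K J) : (toLattice (rightOrder J)).FG := by
  obtain ⟨x, hx, hx0⟩ := exists_mem_ne_zero hJ
  obtain ⟨u, rfl⟩ := exists_unit_of_nrd_ne_zero (hQ x hx0)
  have : IsNoetherian (𝓞 K) J := isNoetherian_of_fg_of_noetherian J hJ.fg
  let f : toLattice (rightOrder J) →ₗ[𝓞 K] J :=
    { toFun := fun m => ⟨u * m.1, m.2 _ hx⟩
      map_add' := fun m m' => Subtype.ext (mul_add _ _ _)
      map_smul' := fun r m => Subtype.ext (mul_smul_comm r (u : Quat a b) m.1) }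
  have hf : Function.Injective f := fun m m' h =>
    Subtype.ext (u.isUnit.mul_right_injective (congrArg Subtype.val h))
  exact Module.Finite.iff_fg.1 (Module.Finite.of_injective f hf)

/-- The relation `n(J) n(J)⁻¹ = ℤ_K`. -/
theorem one_mem_span_inv_mul_nrd (hQ : ∀ x : Quat a b, x ≠ 0 → nrd x ≠ 0)
    {J : Submodule (𝓞 K) (Quat a b)} (hJ : Submodule.IsLattice K J) :
    (1 : K) ∈ Submodule.span (𝓞 K)
      {k | ∃ s, (∀ x ∈ J, IsIntegral (𝓞 K) (s * nrd x)) ∧ ∃ x ∈ J, k = s * nrd x} := by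
  obtain ⟨x, hx, hx0⟩ := exists_mem_ne_zero hJ
  have h := one_mem_span_inv_mul (latticeNorm_isFractional hJ.fg)
    ⟨nrd x, ⟨x, hx, rfl⟩, hQ x hx0⟩
  refine Submodule.span_mono ?_ h
  rintro k ⟨s, hs, _, ⟨y, hy, rfl⟩, rfl⟩
  exact ⟨s, fun x hx => hs _ ⟨x, hx, rfl⟩, y, hy, rfl⟩

/-- The inclusion `J J⁻¹ ∋ 1`, where `J⁻¹ = n(J)⁻¹ (star J)`: an element `z` with `J⁻¹ z ⊆ O_r(J)`
lies in `J`. -/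
theorem mem_of_smul_star_mul_mem (hQ : ∀ x : Quat a b, x ≠ 0 → nrd x ≠ 0)
    {J : Submodule (𝓞 K) (Quat a b)} (hJ : Submodule.IsLattice K J) {z : Quat a b}
    (hz : ∀ s, (∀ x ∈ J, IsIntegral (𝓞 K) (s * nrd x)) → ∀ x ∈ J,
      s • (star x * z) ∈ rightOrder J) : z ∈ J := by
  suffices h : ∀ k ∈ Submodule.span (𝓞 K)
      {k | ∃ s, (∀ x ∈ J, IsIntegral (𝓞 K) (s * nrd x)) ∧ ∃ x ∈ J, k = s * nrd x}, k • z ∈ J by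
    simpa using h 1 (one_mem_span_inv_mul_nrd hQ hJ)
  intro k hk
  induction hk using Submodule.span_induction with
  | mem k hk =>
    obtain ⟨s, hs, x, hx, rfl⟩ := hk
    have := hz s hs x hx x hx
    rwa [mul_smul_comm, ← mul_assoc, mul_star_self_eq, smul_mul_assoc, one_mul, smul_smul] at this
  | zero => rw [zero_smul]; exact zero_mem _
  | add x y _ _ h1 h2 => rw [add_smul]; exact add_mem h1 h2
  | smul r x _ h1 => rw [smul_assoc]; exact J.smul_mem r h1

/-- The inclusion `J J⁻¹ ⊆ O_ℓ(J)`. -/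
theorem smul_mul_star_mem_leftOrder {J : Submodule (𝓞 K) (Quat a b)}
    (hN : IsMaximalOrder (rightOrder J)) {s : K} (hs : ∀ x ∈ J, IsIntegral (𝓞 K) (s * nrd x))
    {x y : Quat a b} (hx : x ∈ J) (hy : y ∈ J) : s • (x * star y) ∈ leftOrder J := by
  intro z hz
  rw [smul_mul_assoc, mul_assoc, ← mul_smul_comm]
  exact hN.smul_star_mul_mem (fun x hx c hc => hc x hx) hs hy hz x hx

/-- The left order of a normal lattice `J` is maximal among the left orders of lattices. -/
theorem leftOrder_le_of_le (hQ : ∀ x : Quat a b, x ≠ 0 → nrd x ≠ 0)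
    {J L : Submodule (𝓞 K) (Quat a b)} (hJ : IsNormal J) (hL : Submodule.IsLattice K L)
    (h : leftOrder J ≤ leftOrder L) : leftOrder L ≤ leftOrder J := by
  intro m hm y hy
  have hfg := leftOrder_fg hQ hL
  refine mem_of_smul_star_mul_mem hQ hJ.1 fun s hs x hx => ?_
  refine hJ.2.mem_of_isIntegral ?_ fun c hc => ?_
  · have h1 : nrd (s • (star x * (m * y))) = s * nrd x * nrd m * (s * nrd y) := by
      rw [nrd_smul, map_mul, map_mul, nrd_star]
      ring
    rw [h1]
    exact ((hs x hx).mul (isIntegral_of_mem_fg hfg hm).2).mul (hs y hy)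
  · have h1 : trd (c * s • (star x * (m * y))) = trd (m * s • (y * c * star x)) := by
      rw [mul_smul_comm, mul_smul_comm, map_smul, map_smul, ← mul_assoc, trd_mul_comm,
        ← mul_assoc, ← mul_assoc, ← mul_assoc]
    rw [h1]
    exact (isIntegral_of_mem_fg hfg
      (mul_mem hm (h (smul_mul_star_mem_leftOrder hJ.2 hs (hc y hy) hx)))).1

/-- If the norms of a right module `A` over a maximal order `N` lie in `𝔠`, then
`(star A) A ⊆ 𝔠 N`. -/
theorem IsMaximalOrder.star_mul_mem_smul {N : Subalgebra (𝓞 K) (Quat a b)} (hN : IsMaximalOrder N)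
    {𝔠 : Ideal (𝓞 K)} (h𝔠 : 𝔠 ≠ ⊥) {A : Submodule (𝓞 K) (Quat a b)}
    (hAN : ∀ x ∈ A, ∀ c ∈ N, x * c ∈ A)
    (hA : ∀ x ∈ A, ∃ c ∈ 𝔠, algebraMap (𝓞 K) K c = nrd x) {x y : Quat a b} (hx : x ∈ A)
    (hy : y ∈ A) : star x * y ∈ 𝔠 • toLattice N := by
  obtain ⟨c, hc, hc0⟩ := Submodule.exists_mem_ne_zero_of_ne_bot h𝔠
  have h1 := one_mem_span_inv_mul (K := K) (T := algebraMap (𝓞 K) K '' 𝔠)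
    (FractionalIdeal.isFractional_of_le_one _ (Submodule.span_le.2 (by
      rintro _ ⟨r, _, rfl⟩
      exact Submodule.mem_one.2 ⟨r, rfl⟩)))
    ⟨algebraMap (𝓞 K) K c, ⟨c, hc, rfl⟩, by simpa using hc0⟩
  suffices h : ∀ k ∈ Submodule.span (𝓞 K)
      {k | ∃ s, (∀ t ∈ algebraMap (𝓞 K) K '' 𝔠, IsIntegral (𝓞 K) (s * t)) ∧
        ∃ t ∈ algebraMap (𝓞 K) K '' 𝔠, k = s * t},
      k • (star x * y) ∈ 𝔠 • toLattice N by
    simpa using h 1 h1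
  intro k hk
  induction hk using Submodule.span_induction with
  | mem k hk =>
    obtain ⟨s, hs, _, ⟨t, ht, rfl⟩, rfl⟩ := hk
    rw [mul_comm, mul_smul, algebraMap_smul]
    refine Submodule.smul_mem_smul ht (hN.smul_star_mul_mem hAN (fun z hz => ?_) hx hy)
    obtain ⟨c, hc, hcz⟩ := hA z hz
    rw [← hcz]
    exact hs _ ⟨c, hc, rfl⟩
  | zero => rw [zero_smul]; exact zero_mem _
  | add x y _ _ h1 h2 => rw [add_smul]; exact add_mem h1 h2
  | smul r x _ h1 => rw [smul_assoc]; exact Submodule.smul_mem _ r h1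

/-- Two comaximal two-sided ideals `A`, `B` of a maximal order `N` whose norms lie in `𝔠` and which
contain `𝔠` exist only for `𝔠 = ℤ_K`. If `1 = e + f` with `e ∈ A` and `f ∈ B`, then
`N = ℤ_K e + ℤ_K f + 𝔠 N`; for proper `𝔠`, Nakayama's lemma would bound the dimension of `Q`
by `2`. -/
theorem IsMaximalOrder.eq_top_of_comaximal {N : Subalgebra (𝓞 K) (Quat a b)}
    (hN : IsMaximalOrder N) {𝔠 : Ideal (𝓞 K)} (h𝔠 : 𝔠 ≠ ⊥)
    {A B : Submodule (𝓞 K) (Quat a b)}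
    (hAN : ∀ x ∈ A, ∀ c ∈ N, x * c ∈ A) (hNA : ∀ x ∈ A, ∀ c ∈ N, c * x ∈ A)
    (hBN : ∀ x ∈ B, ∀ c ∈ N, x * c ∈ B) (hNB : ∀ x ∈ B, ∀ c ∈ N, c * x ∈ B)
    (hAle : ∀ x ∈ A, x ∈ N) (hBle : ∀ x ∈ B, x ∈ N)
    (hA : ∀ x ∈ A, ∃ c ∈ 𝔠, algebraMap (𝓞 K) K c = nrd x)
    (hB : ∀ x ∈ B, ∃ c ∈ 𝔠, algebraMap (𝓞 K) K c = nrd x)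
    (h𝔠A : ∀ c ∈ 𝔠, c • (1 : Quat a b) ∈ A) (h𝔠B : ∀ c ∈ 𝔠, c • (1 : Quat a b) ∈ B)
    {e f : Quat a b} (he : e ∈ A) (hf : f ∈ B) (hef : e + f = 1) : 𝔠 = ⊤ := by
  have hfg : (toLattice N).FG := hN.prop.fg
  obtain ⟨ne, hne, hne'⟩ := hA e he
  obtain ⟨nf, hnf, hnf'⟩ := hB f hf
  -- the norm of `f = 1 - e` shows that `t(e) ≡ 1` modulo `𝔠`
  have ht : ((1 + ne - nf : 𝓞 K) : K) = trd e := by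
    rw [← eq_sub_iff_add_eq'] at hef
    rw [hef, nrd_one_sub] at hnf'
    push_cast
    change 1 + algebraMap (𝓞 K) K ne - algebraMap (𝓞 K) K nf = _
    rw [hnf', hne']
    ring
  have hd : nf - ne ∈ 𝔠 := sub_mem hnf hne
  have hse : star e = f + (ne - nf) • (1 : Quat a b) := by
    rw [star_eq_trd_smul_sub, ← ht, ← hef]
    change algebraMap (𝓞 K) K (1 + ne - nf) • (e + f) - e = _
    rw [algebraMap_smul, hef, add_sub_assoc, add_smul, one_smul, ← hef]
    abel
  have hsf : star f = e + (nf - ne) • (1 : Quat a b) := by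
    have h : star e + star f = 1 := by rw [← star_add, hef, star_one]
    rw [eq_sub_iff_add_eq'.2 h, hse, ← hef]
    have : (nf - ne) • (e + f) = - ((ne - nf) • (e + f)) := by rw [← neg_smul, neg_sub]
    rw [this]
    abel
  have hseB : star e ∈ B := by
    rw [hse]
    exact add_mem hf (h𝔠B _ (sub_mem hne hnf))
  have hsfA : star f ∈ A := by
    rw [hsf]
    exact add_mem he (h𝔠A _ hd)
  -- `c g = g c g + (1 - g) c g`, the first term being congruent to `t(c g) g`
  have key : ∀ g ∈ ({e, f} : Set (Quat a b)), ∀ c ∈ N, ∀ n ∈ 𝔠, algebraMap (𝓞 K) K n = nrd g →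
      g ∈ N → g * c * g ∈ Submodule.span (𝓞 K) {e, f} ⊔ 𝔠 • toLattice N := by
    intro g hg c hc n hn hng hgN
    rw [mul_mul_self_eq, ← hng, algebraMap_smul]
    refine sub_mem (Submodule.mem_sup_left ?_) (Submodule.mem_sup_right ?_)
    · exact smul_mem_of_isIntegral (isIntegral_of_mem_fg hfg (mul_mem hc hgN)).1 _
        (Submodule.subset_span hg)
    · exact Submodule.smul_mem_smul hn (star_mem_of_fg hfg hc)
  have hle : toLattice N ≤
      Submodule.span (𝓞 K) {e, f} ⊔ 𝔠 • toLattice N := by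
    intro c hc
    have h1 := key e (by simp) c hc ne hne hne' (hAle e he)
    have h2 := key f (by simp) c hc nf hnf hnf' (hBle f hf)
    have h3 : f * c * e ∈ 𝔠 • toLattice N := by
      have := hN.star_mul_mem_smul h𝔠 hAN hA hsfA (hNA e he c hc)
      rwa [star_star, ← mul_assoc] at this
    have h4 : e * c * f ∈ 𝔠 • toLattice N := by
      have := hN.star_mul_mem_smul h𝔠 hBN hB hseB (hNB f hf c hc)
      rwa [star_star, ← mul_assoc] at this
    have h5 : c = e * c * e + f * c * f + (f * c * e + e * c * f) := by
      calc c = (e + f) * c * (e + f) := by rw [hef, one_mul, mul_one]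
        _ = _ := by noncomm_ring
    rw [h5]
    exact add_mem (add_mem h1 h2) (Submodule.mem_sup_right (add_mem h3 h4))
  by_contra htop
  obtain ⟨r, hr, hrN⟩ := Submodule.exists_sub_one_mem_and_smul_le_of_fg_of_le_sup hfg le_rfl hle
  have hr0 : algebraMap (𝓞 K) K r ≠ 0 := by
    intro h
    have h0 : r = 0 := by simpa using h
    rw [h0, zero_sub] at hr
    exact htop ((Ideal.eq_top_iff_one _).2 (neg_mem_iff.1 hr))
  have hspan : Submodule.span K ({e, f} : Set (Quat a b)) = ⊤ := by
    rw [eq_top_iff, ← hN.prop.span_eq_top, Submodule.span_le]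
    intro c hc
    have h1 : r • c ∈ Submodule.span (𝓞 K) {e, f} :=
      hrN (Submodule.smul_mem_pointwise_smul c r _ hc)
    have h2 := Submodule.span_le_restrictScalars (𝓞 K) K ({e, f} : Set (Quat a b)) h1
    rw [Submodule.restrictScalars_mem, ← algebraMap_smul K r c] at h2
    have h3 := Submodule.smul_mem _ (algebraMap (𝓞 K) K r)⁻¹ h2
    rwa [smul_smul, inv_mul_cancel₀ hr0, one_smul] at h3
  have h4 : Module.finrank K (Quat a b) = 4 := QuaternionAlgebra.finrank_eq_four _ _ _
  have h5 : Module.finrank K (Submodule.span K ({e, f} : Set (Quat a b))) ≤ 2 := by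
    classical
    have := finrank_span_finset_le_card (R := K) ({e, f} : Finset (Quat a b))
    rw [Finset.coe_insert, Finset.coe_singleton] at this
    exact this.trans Finset.card_le_two
  rw [hspan, finrank_top, h4] at h5
  omega

end NormalLattices

/-! ### Uniqueness of normal lattices -/

section Uniqueness

variable {K : Type*} [Field K] [NumberField K] {a b : K}

/-- The quotient `{α ∈ Q | L α ⊆ J}` of two lattices. -/
def rightColon (L J : Submodule (𝓞 K) (Quat a b)) : Submodule (𝓞 K) (Quat a b) where
  carrier := {α | ∀ l ∈ L, l * α ∈ J}
  zero_mem' l _ := by rw [mul_zero]; exact zero_mem _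
  add_mem' h1 h2 l hl := by rw [mul_add]; exact add_mem (h1 l hl) (h2 l hl)
  smul_mem' r α h l hl := by rw [mul_smul_comm]; exact J.smul_mem r (h l hl)

/-- The ideal `{c ∈ ℤ_K | c n(L) ⊆ n(J)}`. -/
def normColon (L J : Submodule (𝓞 K) (Quat a b)) : Ideal (𝓞 K) where
  carrier := {c | ∀ l ∈ L, c • nrd l ∈ latticeNorm J}
  zero_mem' l _ := by rw [zero_smul]; exact zero_mem _
  add_mem' h1 h2 l hl := by rw [add_smul]; exact add_mem (h1 l hl) (h2 l hl)
  smul_mem' r c h l hl := by rw [smul_assoc]; exact Submodule.smul_mem _ r (h l hl)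

theorem normColon_ne_bot (hQ : ∀ x : Quat a b, x ≠ 0 → nrd x ≠ 0)
    {L J : Submodule (𝓞 K) (Quat a b)} (hL : L.FG) (hJ : Submodule.IsLattice K J) :
    normColon L J ≠ ⊥ := by
  obtain ⟨d, hd, hdL⟩ := latticeNorm_isFractional hL
  obtain ⟨x, hx, hx0⟩ := exists_mem_ne_zero hJ
  obtain ⟨p, q, hq, hpq⟩ := IsFractionRing.div_surjective (A := 𝓞 K) (nrd x)
  have hq0 : algebraMap (𝓞 K) K q ≠ 0 := by simpa using nonZeroDivisors.ne_zero hq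
  have hp : algebraMap (𝓞 K) K p = q • nrd x := by
    rw [Algebra.smul_def, ← hpq, mul_div_cancel₀ _ hq0]
  have hp0 : p ≠ 0 := by
    rintro rfl
    rw [map_zero, zero_div] at hpq
    exact hQ x hx0 hpq.symm
  refine (Submodule.ne_bot_iff _).2 ⟨d * p, fun l hl => ?_, mul_ne_zero
    (nonZeroDivisors.ne_zero hd) hp0⟩
  obtain ⟨r, hr⟩ := hdL (nrd l) (Submodule.subset_span ⟨l, hl, rfl⟩)
  have h : (d * p) • nrd l = r • q • nrd x := by
    rw [← hp, Algebra.smul_def r, hr, mul_smul, smul_comm, Algebra.smul_def p, mul_comm]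
  rw [h]
  exact Submodule.smul_mem _ _ (Submodule.smul_mem _ _ (Submodule.subset_span ⟨x, hx, rfl⟩))

theorem exists_eq_nrd_of_mem_rightColon {N : Subalgebra (𝓞 K) (Quat a b)}
    (hN : (toLattice N).FG) {L J : Submodule (𝓞 K) (Quat a b)} (hLJ : rightColon L J ≤ toLattice N)
    {α : Quat a b} (hα : α ∈ rightColon L J) :
    ∃ c ∈ normColon L J, algebraMap (𝓞 K) K c = nrd α := by
  obtain ⟨c, hc⟩ := IsIntegrallyClosed.isIntegral_iff.1 (isIntegral_of_mem_fg hN (hLJ hα)).2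
  refine ⟨c, fun l hl => ?_, hc⟩
  rw [Algebra.smul_def, hc, mul_comm, ← map_mul]
  exact Submodule.subset_span ⟨_, hα l hl, rfl⟩

/-- If `J ⊆ L` have the same maximal right order, then `n(L)⁻¹ n(J) L ⊆ J`. -/
theorem smul_one_mem_rightColon (hQ : ∀ x : Quat a b, x ≠ 0 → nrd x ≠ 0)
    {J L : Submodule (𝓞 K) (Quat a b)} (hJ : IsNormal J) (hJL : J ≤ L)
    (hr : rightOrder J ≤ rightOrder L) {c : 𝓞 K} (hc : c ∈ normColon L J) :
    c • (1 : Quat a b) ∈ rightColon L J := by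
  intro l hl
  rw [mul_smul_comm, mul_one]
  refine mem_of_smul_star_mul_mem hQ hJ.1 fun s hs x hx => ?_
  rw [mul_smul_comm, ← algebraMap_smul K c, smul_smul]
  refine hJ.2.smul_star_mul_mem (fun x hx c hc => hr hc x hx) (fun y hy => ?_) (hJL hx) hl
  rw [mul_assoc, ← Algebra.smul_def]
  exact isIntegral_mul_nrd_iff.1 hs _ (hc y hy)

/-- A normal lattice is determined by its left order, its right order and its norm. For two
lattices `I`, `J` with the same data and `L = I + J`, the quotients `L⁻¹ I` and `L⁻¹ J` are
comaximal two-sided ideals of the right order, both of norm `n(L)⁻¹ n(J)`. -/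
theorem IsNormal.eq_of_orders_eq (hQ : ∀ x : Quat a b, x ≠ 0 → nrd x ≠ 0)
    {I J : Submodule (𝓞 K) (Quat a b)} (hI : IsNormal I) (hJ : IsNormal J)
    (hl : leftOrder I = leftOrder J) (hr : rightOrder I = rightOrder J)
    (hn : latticeNorm I = latticeNorm J) : I = J := by
  have hIl := hI.1
  have hJl := hJ.1
  have hLl : Submodule.IsLattice K (I ⊔ J) := inferInstance
  have hrL : rightOrder J ≤ rightOrder (I ⊔ J) := fun c hc z hz => by
    obtain ⟨x, hx, y, hy, rfl⟩ := Submodule.mem_sup.1 hz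
    rw [add_mul]
    exact Submodule.add_mem_sup ((hr ▸ hc : c ∈ rightOrder I) x hx) (hc y hy)
  have hlL : leftOrder J ≤ leftOrder (I ⊔ J) := fun c hc z hz => by
    obtain ⟨x, hx, y, hy, rfl⟩ := Submodule.mem_sup.1 hz
    rw [mul_add]
    exact Submodule.add_mem_sup ((hl ▸ hc : c ∈ leftOrder I) x hx) (hc y hy)
  have hNl : Submodule.IsLattice K (toLattice (rightOrder J)) := hJ.2.prop
  have hNL : Submodule.IsLattice K (toLattice (rightOrder (I ⊔ J))) :=
    Submodule.IsLattice.of_le_of_isLattice_of_fg K (M := toLattice (rightOrder J)) hrL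
      (rightOrder_fg hQ hLl)
  have hrL' : rightOrder (I ⊔ J) ≤ rightOrder J := hJ.2.le_of_ge hNL hrL
  have hNLmax : IsMaximalOrder (rightOrder (I ⊔ J)) := le_antisymm hrL' hrL ▸ hJ.2
  have hlL' : leftOrder (I ⊔ J) ≤ leftOrder J := leftOrder_le_of_le hQ hJ hLl hlL
  have hnorm : normColon (I ⊔ J) I = normColon (I ⊔ J) J := by
    ext c
    change (∀ l ∈ I ⊔ J, c • nrd l ∈ latticeNorm I) ↔ (∀ l ∈ I ⊔ J, c • nrd l ∈ latticeNorm J)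
    rw [hn]
  have hAle : rightColon (I ⊔ J) I ≤ toLattice (rightOrder J) := fun α hα =>
    hrL' fun x hx => Submodule.mem_sup_left (hα x hx)
  have hBle : rightColon (I ⊔ J) J ≤ toLattice (rightOrder J) := fun α hα =>
    hrL' fun x hx => Submodule.mem_sup_right (hα x hx)
  -- the relation `L⁻¹ L ∋ 1` splits along `L = I + J`
  have h1 : (1 : Quat a b) ∈ rightColon (I ⊔ J) I ⊔ rightColon (I ⊔ J) J := by
    suffices h : ∀ k ∈ Submodule.span (𝓞 K)
        {k | ∃ s, (∀ x ∈ I ⊔ J, IsIntegral (𝓞 K) (s * nrd x)) ∧ ∃ x ∈ I ⊔ J, k = s * nrd x},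
        k • (1 : Quat a b) ∈ rightColon (I ⊔ J) I ⊔ rightColon (I ⊔ J) J by
      simpa using h 1 (one_mem_span_inv_mul_nrd hQ hLl)
    intro k hk
    induction hk using Submodule.span_induction with
    | mem k hk =>
      obtain ⟨s, hs, l, hlm, rfl⟩ := hk
      have hmem : ∀ {M : Submodule (𝓞 K) (Quat a b)}, leftOrder (I ⊔ J) ≤ leftOrder M →
          ∀ x ∈ M, s • (star l * x) ∈ rightColon (I ⊔ J) M := fun {M} hM x hx l' hl' => by
        have := hM (smul_mul_star_mem_leftOrder hNLmax hs hl' hlm) x hx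
        rwa [smul_mul_assoc, mul_assoc, ← mul_smul_comm] at this
      obtain ⟨x, hx, y, hy, hxy⟩ := Submodule.mem_sup.1 hlm
      have e : (s * nrd l) • (1 : Quat a b) = s • (star l * x) + s • (star l * y) := by
        rw [← smul_add, ← mul_add, hxy, star_mul_self_eq, smul_smul]
      rw [e]
      exact Submodule.add_mem_sup (hmem (hl ▸ hlL') x hx) (hmem hlL' y hy)
    | zero => rw [zero_smul]; exact zero_mem _
    | add x y _ _ h1 h2 => rw [add_smul]; exact add_mem h1 h2
    | smul r x _ h1 => rw [smul_assoc]; exact Submodule.smul_mem _ r h1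
  obtain ⟨e, he, f, hf, hef⟩ := Submodule.mem_sup.1 h1
  have htop : normColon (I ⊔ J) J = ⊤ := by
    refine hJ.2.eq_top_of_comaximal (normColon_ne_bot hQ hLl.fg hJl)
      (A := rightColon (I ⊔ J) I) (B := rightColon (I ⊔ J) J)
      (fun x hx c hc l hlm => ?_) (fun x hx c hc l hlm => ?_)
      (fun x hx c hc l hlm => ?_) (fun x hx c hc l hlm => ?_) hAle hBle
      (fun x hx => hnorm ▸ exists_eq_nrd_of_mem_rightColon hNl.fg hAle hx)
      (fun x hx => exists_eq_nrd_of_mem_rightColon hNl.fg hBle hx)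
      (fun c hc => smul_one_mem_rightColon hQ hI le_sup_left (hr ▸ hrL) (hnorm ▸ hc))
      (fun c hc => smul_one_mem_rightColon hQ hJ le_sup_right hrL hc) he hf hef
    · rw [← mul_assoc]
      exact (hr ▸ hc : c ∈ rightOrder I) _ (hx l hlm)
    · rw [← mul_assoc]
      exact hx _ (hrL hc l hlm)
    · rw [← mul_assoc]
      exact hc _ (hx l hlm)
    · rw [← mul_assoc]
      exact hx _ (hrL hc l hlm)
  have hone : (1 : 𝓞 K) ∈ normColon (I ⊔ J) J := htop ▸ Submodule.mem_top
  have hI1 := smul_one_mem_rightColon hQ hI le_sup_left (hr ▸ hrL) (hnorm ▸ hone)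
  have hJ1 := smul_one_mem_rightColon hQ hJ le_sup_right hrL hone
  rw [one_smul] at hI1 hJ1
  refine le_antisymm (fun x hx => ?_) fun x hx => ?_
  · simpa using hJ1 x (Submodule.mem_sup_left hx)
  · simpa using hI1 x (Submodule.mem_sup_right hx)

end Uniqueness

/-! ### Normalisers and the classification -/

section TwoSidedMul

variable {K : Type*} [Field K] {a b : K}

theorem mem_twoSidedMul {α β : (Quat a b)ˣ} {J : Submodule (𝓞 K) (Quat a b)} {y : Quat a b} :
    y ∈ twoSidedMul α β J ↔ ((α⁻¹ : (Quat a b)ˣ) : Quat a b) * y * β ∈ J := by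
  constructor
  · rintro ⟨x, hx, rfl⟩
    change ((α⁻¹ : (Quat a b)ˣ) : Quat a b) * (α * x * ((β⁻¹ : (Quat a b)ˣ) : Quat a b)) * β ∈ J
    simpa [mul_assoc] using hx
  · intro h
    refine ⟨_, h, ?_⟩
    change α * (((α⁻¹ : (Quat a b)ˣ) : Quat a b) * y * β) * ((β⁻¹ : (Quat a b)ˣ) : Quat a b) = y
    simp [mul_assoc]

theorem twoSidedMul_twoSidedMul (α β α' β' : (Quat a b)ˣ) (J : Submodule (𝓞 K) (Quat a b)) :
    twoSidedMul α β (twoSidedMul α' β' J) = twoSidedMul (α * α') (β * β') J := by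
  ext y
  simp [mem_twoSidedMul, mul_assoc]

theorem twoSidedMul_one_one (J : Submodule (𝓞 K) (Quat a b)) : twoSidedMul 1 1 J = J := by
  ext y
  simp [mem_twoSidedMul]

theorem leftMul_eq_twoSidedMul (α : (Quat a b)ˣ) (J : Submodule (𝓞 K) (Quat a b)) :
    leftMul α J = twoSidedMul α 1 J := by
  ext y
  rw [mem_twoSidedMul]
  constructor
  · rintro ⟨x, hx, rfl⟩
    change ((α⁻¹ : (Quat a b)ˣ) : Quat a b) * (α * x) * ((1 : (Quat a b)ˣ) : Quat a b) ∈ J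
    simpa [mul_assoc] using hx
  · intro h
    refine ⟨_, h, ?_⟩
    change α * (((α⁻¹ : (Quat a b)ˣ) : Quat a b) * y * ((1 : (Quat a b)ˣ) : Quat a b)) = y
    simp

theorem mem_leftOrder_twoSidedMul {α β : (Quat a b)ˣ} {J : Submodule (𝓞 K) (Quat a b)}
    {m : Quat a b} : m ∈ leftOrder (twoSidedMul α β J) ↔
      ((α⁻¹ : (Quat a b)ˣ) : Quat a b) * m * α ∈ leftOrder J := by
  constructor
  · intro h x hx
    have := mem_twoSidedMul.1 (h (α * x * ((β⁻¹ : (Quat a b)ˣ) : Quat a b))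
      (mem_twoSidedMul.2 (by simpa [mul_assoc] using hx)))
    simpa [mul_assoc] using this
  · intro h x hx
    rw [mem_twoSidedMul] at hx ⊢
    simpa [mul_assoc] using h _ hx

theorem mem_rightOrder_twoSidedMul {α β : (Quat a b)ˣ} {J : Submodule (𝓞 K) (Quat a b)}
    {m : Quat a b} : m ∈ rightOrder (twoSidedMul α β J) ↔
      ((β⁻¹ : (Quat a b)ˣ) : Quat a b) * m * β ∈ rightOrder J := by
  constructor
  · intro h x hx
    have := mem_twoSidedMul.1 (h (α * x * ((β⁻¹ : (Quat a b)ˣ) : Quat a b))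
      (mem_twoSidedMul.2 (by simpa [mul_assoc] using hx)))
    simpa [mul_assoc] using this
  · intro h x hx
    rw [mem_twoSidedMul] at hx ⊢
    simpa [mul_assoc] using h _ hx

theorem mem_orderNormalizer_iff_inv {α : (Quat a b)ˣ} {M : Subalgebra (𝓞 K) (Quat a b)} :
    α ∈ orderNormalizer M ↔
      ∀ x : Quat a b, ((α⁻¹ : (Quat a b)ˣ) : Quat a b) * x * α ∈ M ↔ x ∈ M := by
  rw [← inv_mem_iff]
  change (∀ x : Quat a b, x ∈ M ↔ ((α⁻¹ : (Quat a b)ˣ) : Quat a b) * x *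
    (((α⁻¹)⁻¹ : (Quat a b)ˣ) : Quat a b) ∈ M) ↔ _
  simp only [inv_inv, iff_comm]

theorem isLattice_latticeImage (φ : Quat a b ≃ₗ[K] Quat a b) {J : Submodule (𝓞 K) (Quat a b)}
    (hJ : Submodule.IsLattice K J) : Submodule.IsLattice K (latticeImage φ.toLinearMap J) where
  fg := hJ.fg.map _
  span_eq_top := by
    change Submodule.span K (φ.toLinearMap '' J) = ⊤
    rw [← Submodule.map_span, hJ.span_eq_top, Submodule.map_top]
    exact LinearEquiv.range φ

theorem latticeNorm_twoSidedMul_le {α β : (Quat a b)ˣ} (h : normRatio (α, β) ∈ integralUnits K)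
    (J : Submodule (𝓞 K) (Quat a b)) : latticeNorm (twoSidedMul α β J) ≤ latticeNorm J := by
  obtain ⟨v, hv⟩ := h
  refine Submodule.span_le.2 ?_
  rintro _ ⟨_, ⟨x, hx, rfl⟩, rfl⟩
  have h1 : algebraMap (𝓞 K) K v =
      nrd (α : Quat a b) * nrd ((β⁻¹ : (Quat a b)ˣ) : Quat a b) := congrArg Units.val hv
  have h2 : nrd ((α : Quat a b) * x * ((β⁻¹ : (Quat a b)ˣ) : Quat a b)) = (v : 𝓞 K) • nrd x := by
    rw [Algebra.smul_def, h1, map_mul, map_mul]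
    ring
  change nrd ((α : Quat a b) * x * ((β⁻¹ : (Quat a b)ˣ) : Quat a b)) ∈ latticeNorm J
  rw [h2]
  exact Submodule.smul_mem _ _ (Submodule.subset_span ⟨x, hx, rfl⟩)

theorem latticeNorm_twoSidedMul {α β : (Quat a b)ˣ} (h : normRatio (α, β) ∈ integralUnits K)
    (J : Submodule (𝓞 K) (Quat a b)) : latticeNorm (twoSidedMul α β J) = latticeNorm J := by
  refine le_antisymm (latticeNorm_twoSidedMul_le h J) ?_
  have h' : normRatio (α⁻¹, β⁻¹) ∈ integralUnits K := by
    rw [← Prod.inv_mk, map_inv]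
    exact inv_mem h
  have := latticeNorm_twoSidedMul_le h' (twoSidedMul α β J)
  rwa [twoSidedMul_twoSidedMul, inv_mul_cancel, inv_mul_cancel, twoSidedMul_one_one] at this

theorem normRatio_apply (α β : (Quat a b)ˣ) :
    normRatio (α, β) = unitNrd α * (unitNrd β)⁻¹ := by
  rw [← map_inv]
  rfl

end TwoSidedMul

section TotallyReal

variable {K : Type*} [Field K] [NumberField K] [NumberField.IsTotallyReal K] {a b : K}

/-- Among the pairs with `n(α) n(β⁻¹) ∈ ℤ_K^*`, those in `𝔑(J)` are exactly those which stabilise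
`J`. -/
theorem IsNormal.mem_pairNormalizer_iff (ha : TotallyPositive a) (hb : TotallyPositive b)
    {J : Submodule (𝓞 K) (Quat a b)} (hJ : IsNormal J) {α β : (Quat a b)ˣ}
    (h : normRatio (α, β) ∈ integralUnits K) :
    (α, β) ∈ pairNormalizer J ↔ twoSidedMul α β J = J := by
  have hQ : ∀ x : Quat a b, x ≠ 0 → nrd x ≠ 0 := fun x hx h => hx ((nrd_eq_zero ha hb).1 h)
  constructor
  · rintro ⟨⟨hα, hβ⟩, -⟩
    have hr : rightOrder (twoSidedMul α β J) = rightOrder J := by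
      ext m
      rw [mem_rightOrder_twoSidedMul]
      exact mem_orderNormalizer_iff_inv.1 hβ m
    have hl : leftOrder (twoSidedMul α β J) = leftOrder J := by
      ext m
      rw [mem_leftOrder_twoSidedMul]
      exact mem_orderNormalizer_iff_inv.1 hα m
    exact IsNormal.eq_of_orders_eq hQ ⟨isLattice_latticeImage (sandwich α β) hJ.1, hr ▸ hJ.2⟩ hJ
      hl hr (latticeNorm_twoSidedMul h J)
  · intro hJ'
    refine ⟨⟨mem_orderNormalizer_iff_inv.2 fun m => ?_, mem_orderNormalizer_iff_inv.2 fun m => ?_⟩,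
      h⟩
    · change _ * m * (α : Quat a b) ∈ leftOrder J ↔ m ∈ leftOrder J
      rw [← mem_leftOrder_twoSidedMul (β := β), hJ']
    · change _ * m * (β : Quat a b) ∈ rightOrder J ↔ m ∈ rightOrder J
      rw [← mem_rightOrder_twoSidedMul (α := α), hJ']

theorem properlyIsometric_iff (ha : TotallyPositive a) (hb : TotallyPositive b)
    {L L' : Submodule (𝓞 K) (Quat a b)} : ProperlyIsometric L L' ↔
      ∃ α β : (Quat a b)ˣ, unitNrd α = unitNrd β ∧ twoSidedMul α β L = L' := by
  constructor
  · rintro ⟨φ, hφ, h⟩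
    obtain ⟨α, β, hαβ, rfl⟩ := exists_eq_sandwich ha hb hφ
    exact ⟨α, β, hαβ, h⟩
  · rintro ⟨α, β, hαβ, h⟩
    exact ⟨sandwich α β, sandwich_mem_properIsometries hαβ, h⟩

theorem mem_properAut_iff (ha : TotallyPositive a) (hb : TotallyPositive b)
    {J : Submodule (𝓞 K) (Quat a b)} (hJ : IsNormal J) {φ : Quat a b ≃ₗ[K] Quat a b} :
    φ ∈ properAut J ↔ ∃ α β : (Quat a b)ˣ, (α, β) ∈ pairNormalizer J ∧ unitNrd α = unitNrd β ∧
      φ = sandwich α β := by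
  have hint : ∀ {α β : (Quat a b)ˣ}, unitNrd α = unitNrd β →
      normRatio (α, β) ∈ integralUnits K := fun {α β} h => by
    rw [normRatio_apply, h, mul_inv_cancel]
    exact one_mem _
  constructor
  · rintro ⟨hφ, h⟩
    obtain ⟨α, β, hαβ, rfl⟩ := exists_eq_sandwich ha hb hφ
    exact ⟨α, β, (hJ.mem_pairNormalizer_iff ha hb (hint hαβ)).2 h, hαβ, rfl⟩
  · rintro ⟨α, β, hp, hαβ, rfl⟩
    exact ⟨sandwich_mem_properIsometries hαβ,
      (hJ.mem_pairNormalizer_iff ha hb (hint hαβ)).1 hp⟩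

end TotallyReal

section Conjugation

variable {K : Type*} [Field K] {a b : K}

/-- Left multiplication by `α` scales `n` by `n(α)`, so conjugation by it preserves `SO(Q, n)`. -/
theorem conj_mulLeft_mem_properIsometries (α : (Quat a b)ˣ) {φ : Quat a b ≃ₗ[K] Quat a b}
    (hφ : φ ∈ properIsometries a b) :
    MulAut.conj (Units.mulLeftLinearEquiv K (Quat a b) α) φ ∈ properIsometries a b := by
  refine ⟨fun x => ?_, ?_⟩
  · change nrd ((α : Quat a b) * φ (((α⁻¹ : (Quat a b)ˣ) : Quat a b) * x)) = nrd x
    rw [map_mul, hφ.1, ← map_mul, Units.mul_inv_cancel_left]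
  · rw [MulAut.conj_apply, map_mul, map_mul, hφ.2, map_inv, mul_one, mul_inv_cancel]

theorem conj_mulLeft_mem_properAut (α : (Quat a b)ˣ) {J : Submodule (𝓞 K) (Quat a b)}
    {φ : Quat a b ≃ₗ[K] Quat a b} (hφ : φ ∈ properAut J) :
    MulAut.conj (Units.mulLeftLinearEquiv K (Quat a b) α) φ ∈ properAut (leftMul α J) := by
  refine ⟨conj_mulLeft_mem_properIsometries α hφ.1, ?_⟩
  have h : (MulAut.conj (Units.mulLeftLinearEquiv K (Quat a b) α) φ).toLinearMap ∘ₗ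
      LinearMap.mulLeft K (α : Quat a b) = LinearMap.mulLeft K (α : Quat a b) ∘ₗ φ.toLinearMap := by
    ext1 x
    change (α : Quat a b) * φ (((α⁻¹ : (Quat a b)ˣ) : Quat a b) * (α * x)) = α * φ x
    rw [Units.inv_mul_cancel_left]
  rw [leftMul, ← latticeImage_comp, h, latticeImage_comp]
  exact congrArg _ hφ.2

theorem properAut_leftMul (α : (Quat a b)ˣ) (J : Submodule (𝓞 K) (Quat a b)) :
    properAut (leftMul α J) = conjLeft α (properAut J) := by
  refine le_antisymm (fun φ hφ => ?_) ?_
  · have h := conj_mulLeft_mem_properAut α⁻¹ hφ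
    rw [leftMul_eq_twoSidedMul, leftMul_eq_twoSidedMul, twoSidedMul_twoSidedMul, inv_mul_cancel,
      one_mul, twoSidedMul_one_one] at h
    refine ⟨_, h, ?_⟩
    change MulAut.conj _ (MulAut.conj _ φ) = φ
    rw [map_inv, map_inv, ← MulAut.mul_apply, mul_inv_cancel, MulAut.one_apply]
  · rintro _ ⟨φ, hφ, rfl⟩
    exact conj_mulLeft_mem_properAut α hφ

end Conjugation

end NormalLattice

theorem mainTheorem4 {K : Type*} [Field K] [NumberField K] [NumberField.IsTotallyReal K]
    (a b : K) (ha : NormalLattice.TotallyPositive a) (hb : NormalLattice.TotallyPositive b)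
    (𝔞 : FractionalIdeal (𝓞 K)⁰ K)
    (J : Submodule (𝓞 K) (NormalLattice.Quat a b)) (hJ : NormalLattice.IsNormal J)
    (hJ𝔞 : NormalLattice.latticeNorm J = (𝔞 : Submodule (𝓞 K) K)) :
    (∀ α : NormalLattice.UnitQuotient J → (NormalLattice.Quat a b)ˣ,
      (∀ u, ∃ t : NormalLattice.totPosUnits K,
        (t : Kˣ) = NormalLattice.unitNrd (α u) ∧ (QuotientGroup.mk t : NormalLattice.UnitQuotient J) = u) →
      (∀ u, NormalLattice.leftMul (α u) J ∈ NormalLattice.normalisedClass J) ∧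
      (∀ I ∈ NormalLattice.normalisedClass J,
        ∃! u, NormalLattice.ProperlyIsometric I (NormalLattice.leftMul (α u) J)) ∧
      (∀ u, NormalLattice.properAut (NormalLattice.leftMul (α u) J) =
        NormalLattice.conjLeft (α u) (NormalLattice.properAut J))) ∧
    (∀ φ : NormalLattice.Quat a b ≃ₗ[K] NormalLattice.Quat a b,
      φ ∈ NormalLattice.properAut J ↔
        ∃ α β : (NormalLattice.Quat a b)ˣ,
          (α, β) ∈ NormalLattice.pairNormalizer J ∧
          NormalLattice.unitNrd α = NormalLattice.unitNrd β ∧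
          ∀ γ : NormalLattice.Quat a b,
            φ γ = (α : NormalLattice.Quat a b) * γ *
              ((β⁻¹ : (NormalLattice.Quat a b)ˣ) : NormalLattice.Quat a b)) := by
  open NormalLattice in
  refine ⟨fun α hα => ⟨fun u => ?_, fun I hI => ?_, fun u => properAut_leftMul (α u) J⟩,
    fun φ => ?_⟩
  · obtain ⟨t, ht, -⟩ := hα u
    refine ⟨α u, 1, ?_, leftMul_eq_twoSidedMul _ _⟩
    rw [normRatio_apply, map_one, inv_one, mul_one, ← ht]
    exact t.2.1
  · obtain ⟨x, y, hxy, rfl⟩ := hI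
    have hpos : normRatio (x, y) ∈ totPosUnits K := ⟨hxy, fun σ => by
      have h1 := unitNrd_totallyPositive ha hb x σ
      have h2 := unitNrd_totallyPositive ha hb y⁻¹ σ
      simpa [normRatio] using mul_pos h1 h2⟩
    -- the class `u` is the one of the norm ratio of `I = x J y⁻¹`
    refine ⟨QuotientGroup.mk ⟨normRatio (x, y), hpos⟩, ?_, fun u' hu' => ?_⟩
    · obtain ⟨t, ht, htu⟩ := hα (QuotientGroup.mk ⟨normRatio (x, y), hpos⟩)
      set z := α (QuotientGroup.mk ⟨normRatio (x, y), hpos⟩)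
      obtain ⟨⟨c, d⟩, hcd, hcd'⟩ : (t : Kˣ)⁻¹ * normRatio (x, y) ∈ normUnits J :=
        Subgroup.mem_subgroupOf.1 (QuotientGroup.eq.1 htu)
      have hstab := (hJ.mem_pairNormalizer_iff ha hb hcd.2).1 hcd
      refine (properlyIsometric_iff ha hb).2 ⟨z * c * x⁻¹, 1 * d * y⁻¹, ?_, ?_⟩
      · rw [ht, normRatio_apply, normRatio_apply] at hcd'
        rw [one_mul, map_mul, map_mul, map_mul, map_inv, map_inv, mul_inv_eq_iff_eq_mul.1 hcd',
          mul_assoc (unitNrd z)⁻¹, mul_inv_cancel_left, mul_right_comm, mul_inv_cancel_comm,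
          mul_comm]
      · rw [twoSidedMul_twoSidedMul, inv_mul_cancel_right, inv_mul_cancel_right,
          ← twoSidedMul_twoSidedMul, hstab, leftMul_eq_twoSidedMul]
    · obtain ⟨t, ht, rfl⟩ := hα u'
      set z := α (QuotientGroup.mk t)
      obtain ⟨c, d, hcd, h⟩ := (properlyIsometric_iff ha hb).1 hu'
      refine QuotientGroup.eq.2 (Subgroup.mem_subgroupOf.2 ?_)
      have hratio : normRatio (z⁻¹ * (c * x), d * y) = (t : Kˣ)⁻¹ * normRatio (x, y) := by
        rw [ht, normRatio_apply, normRatio_apply]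
        rw [map_mul, map_mul, map_mul, map_inv, hcd, mul_assoc, mul_inv, mul_mul_mul_comm,
          mul_inv_cancel, one_mul]
      refine ⟨(z⁻¹ * (c * x), d * y), ?_, hratio⟩
      rw [SetLike.mem_coe, hJ.mem_pairNormalizer_iff ha hb
        (hratio ▸ mul_mem (inv_mem t.2.1) hxy)]
      rw [twoSidedMul_twoSidedMul, leftMul_eq_twoSidedMul] at h
      have h' := congrArg (twoSidedMul z⁻¹ 1) h
      rwa [twoSidedMul_twoSidedMul, twoSidedMul_twoSidedMul, inv_mul_cancel, one_mul, one_mul,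
        twoSidedMul_one_one] at h'
  · rw [mem_properAut_iff ha hb hJ]
    refine exists_congr fun x => exists_congr fun y => and_congr_right fun _ =>
      and_congr_right fun _ => LinearEquiv.ext_iff
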